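/- **Setting.** Let $n\ge 2$, and let $z=(z_1,\dots,z_n)\in\mathbb C^n$ satisfy $z_a-z_b\notin\mathbb Z$ for all $a\ne b$. Let $$H_z=\mathbb C[x]\Big/\Big\langle\prod_{a=1}^n(x-z_a)\Big\rangle$$ be the $T^n$-equivariant cohomology algebra of $P^{n-1}$ with equivariant parameters specialized to $z$. Let $y_1,\dots,y_{n-1}$ be the equivariant Chern roots of the quotient bundle with fiber $\mathbb C^n/F$ over the line $F$; their symmetric functions are the elements of $H_z$ determined by $$(u-x)\prod_{j=1}^{n-1}(u-y_j)=\prod_{a=1}^n(u-z_a).$$ For $p\ne0$ with a chosen argument, and for $J=1,\dots,n$ and $m\in\mathbb Z$, put $$\Phi(t,p,z)=\bigl(e^{\pi i(2-n)}p\bigr)^t\prod_{a=1}^n\Gamma(z_a-t),\qquad W(t,y)=\prod_{j=1}^{n-1}(y_j-t),$$ $$\Psi_J(p,y,z)=-\sum_{k=0}^\infty\operatorname{Res}_{t=z_J+k}\bigl(\Phi(t,p,z)\,W(t,y)\bigr),\qquad \Psi^m(p,y,z)=\sum_{J=1}^n e^{2\pi i(m-1)z_J}\,\Psi_J(p,y,z),$$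 which are $H_z$-valued functions. **Lemma.** Let $m\in\mathbb Z$ and $\phi\in\mathbb R$ satisfy $\frac mn-1<\phi<\frac mn$. Put $s=re^{-2\pi i\phi}$ with $r>0$, $\omega=e^{2\pi i/n}$ and $p=s^n$, where $\arg p=-2\pi n\phi$. Then, as $r\to\infty$, $$\Psi^m(s^n,y,z)=\frac{(2\pi)^{(n-1)/2}}{\sqrt n}\;e^{n\omega^m s}\,(-\omega^m s)^{\sum_{a=1}^n z_a+(1-n)/2}\,\prod_{j=1}^{n-1}(y_j-\omega^m s)\,\bigl(1+\mathcal O(1/s)\bigr),$$ where the power of $-\omega^m s$ is taken with $\arg(-\omega^m s)=2\pi m/n-\pi-2\pi\phi$, so that $|\arg(-\omega^m s)|<\pi$. Here $\mathcal O(1/s)$ is an $H_z$-valued function of $r$ whose norm, in any fixed norm on the finite-dimensional space $H_z$, is at most a constant times $1/r$ for all large $r$. -/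

import Mathlib

open Polynomial Asymptotics Filter Topology

noncomputable section

namespace QuantumPn

/-- The residue at `c` of a function `f` with values in a normed space: the limit of
`(2πi)⁻¹ ∮ f(t) dt` over the positively oriented circles of radius `ε → 0+` around `c`. For `f`
holomorphic in a punctured neighbourhood of `c` the integral does not depend on small `ε`. -/
def residue {E : Type*} [NormedAddCommGroup E] [NormedSpace ℂ E] (f : ℂ → E) (c : ℂ) : E :=
  limUnder (𝓝[>] (0 : ℝ)) fun ε : ℝ =>
    (2 * (Real.pi : ℂ) * Complex.I)⁻¹ • ∮ t in C(c, ε), f t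

/-- The polynomial `∏_a (u - z_a)`. -/
def weightPoly {n : ℕ} (z : Fin n → ℂ) : ℂ[X] := ∏ a, (X - C (z a))

lemma weightPoly_monic {n : ℕ} (z : Fin n → ℂ) : (weightPoly z).Monic :=
  monic_prod_of_monic _ _ fun a _ => monic_X_sub_C (z a)

/-- The equivariant cohomology algebra `ℂ[x] / ⟨∏_a (x - z_a)⟩` of `P^{n-1}` with the equivariant
parameters specialized to the complex numbers `z_1, …, z_n`. -/
def EqCohomology {n : ℕ} (z : Fin n → ℂ) : Type := AdjoinRoot (weightPoly z)

namespace EqCohomology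

variable {n : ℕ} (z : Fin n → ℂ)

instance : CommRing (EqCohomology z) := inferInstanceAs (CommRing (AdjoinRoot (weightPoly z)))

instance : Algebra ℂ (EqCohomology z) :=
  inferInstanceAs (Algebra ℂ (AdjoinRoot (weightPoly z)))

/-- The basis `1, x, …, x^{n-1}` of the algebra over `ℂ`. -/
def basis : Module.Basis (Fin (weightPoly z).natDegree) ℂ (EqCohomology z) :=
  (AdjoinRoot.powerBasis' (weightPoly_monic z)).basis

/-- The maximum norm of the coordinates in the basis `1, x, …, x^{n-1}`. The algebra has finite
dimension over `ℂ`, so every other norm on this vector space is equivalent to it. -/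
instance : NormedAddCommGroup (EqCohomology z) :=
  NormedAddCommGroup.induced (EqCohomology z) (Fin (weightPoly z).natDegree → ℂ)
    (basis z).equivFun (basis z).equivFun.injective

instance : NormedSpace ℂ (EqCohomology z) :=
  NormedSpace.induced ℂ (EqCohomology z) (Fin (weightPoly z).natDegree → ℂ) (basis z).equivFun

/-- The equivariant first Chern class `x` of the tautological line bundle. -/
def x : EqCohomology z := AdjoinRoot.root (weightPoly z)

/-- The polynomial `∏_j (u - y_j)` in `u`, where `y_1, …, y_{n-1}` are the equivariant Chern roots
of the quotient bundle with fibre `ℂⁿ / F`. Its coefficients, the symmetric functions of the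
`y_j`, lie in the algebra; they are given by the relation
`(u - x) ∏_j (u - y_j) = ∏_a (u - z_a)`. -/
def chernRootPoly : (EqCohomology z)[X] :=
  (weightPoly z).map (algebraMap ℂ (EqCohomology z)) /ₘ (X - C (x z))

/-- The defining relation `(u - x) ∏_j (u - y_j) = ∏_a (u - z_a)` of the Chern roots. -/
lemma X_sub_C_x_mul_chernRootPoly :
    (X - C (x z)) * chernRootPoly z = (weightPoly z).map (algebraMap ℂ (EqCohomology z)) := by
  refine mul_divByMonic_eq_iff_isRoot.2 ?_
  rw [IsRoot.def, eval_map]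
  exact AdjoinRoot.eval₂_root (weightPoly z)

/-- The class `∏_{j=1}^{n-1} (y_j - t)`, that is, `(-1)^{n-1} ∏_j (t - y_j)`. -/
def W (t : ℂ) : EqCohomology z :=
  (-1) ^ (n - 1) * (chernRootPoly z).eval (algebraMap ℂ (EqCohomology z) t)

end EqCohomology

variable {n : ℕ}

/-- The master function `Φ(t, p, z) = (e^{πi(2-n)} p)^t ∏_a Γ(z_a - t)`. The variable `p ≠ 0` with
a fixed argument is given through its logarithm `logp = log |p| + i arg p`. -/
def masterFunction (t logp : ℂ) (z : Fin n → ℂ) : ℂ :=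
  Complex.exp (t * (logp + Real.pi * Complex.I * (2 - (n : ℂ)))) * ∏ a, Complex.Gamma (z a - t)

/-- The Jackson integral `Ψ_J = - ∑_{k ≥ 0} Res_{t = z_J + k} Φ(t, p, z) W(t, y)`. -/
def PsiJ (J : Fin n) (logp : ℂ) (z : Fin n → ℂ) : EqCohomology z :=
  -∑' k : ℕ, residue (fun t : ℂ => masterFunction t logp z • EqCohomology.W z t) (z J + k)

/-- The solution `Ψ_Q = ∑_J Q(e^{2πi z_J}, e^{2πi z_1}, …, e^{2πi z_n}) Ψ_J`, where the Laurent
polynomial `Q(X, Z)` is given as a function of its arguments. -/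
def PsiQ (Q : ℂ → (Fin n → ℂ) → ℂ) (logp : ℂ) (z : Fin n → ℂ) : EqCohomology z :=
  ∑ J, Q (Complex.exp (2 * Real.pi * Complex.I * z J))
    (fun a => Complex.exp (2 * Real.pi * Complex.I * z a)) • PsiJ J logp z

/-- The solution `Ψ^m`, which is `Ψ_Q` for the Laurent monomial `Q = X^{m-1}`. -/
def Psi (m : ℤ) (logp : ℂ) (z : Fin n → ℂ) : EqCohomology z :=
  PsiQ (fun T _ => T ^ (m - 1)) logp z

end QuantumPn

end

/-!
Restricted to the fixed point `b`, where `x = z_b` and the `y_j` are the `z_a` with `a ≠ b`, the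
class `Ψ^m` becomes, up to elementary factors, the sum of the residues of a Mellin–Barnes kernel
`(S/n)^{-w} ∏_a Γ(α_a + w/n)` with `∑_a α_a = (n - 1)/2`, where `S = -n ω^m s`. Stirling's formula
with its first correction shows that, up to a constant factor, this kernel is
`S^{-w} (Γ(w) + κ Γ(w - 1) + O(Γ(w)/w²))` away from the negative real axis. The residues of
`S^{-w} Γ(w)` at all its poles add up to exactly `e^{-S}`, and those of `S^{-w} Γ(w - 1)` to
`S^{-1} e^{-S}`. What remains is the integral of the `O`-term over a contour around the poles, open
to the left, which is taken through the saddle point `w = S`; the integral is `O(S^{-1} e^{-S})`.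
-/

noncomputable section

namespace QuantumPn

open Complex Set

/-- The distance of `w` from the negative real axis, up to constants: it is positive exactly on the
slit plane, and its size governs the error in Stirling's formula. -/
def negAxisDist (w : ℂ) : ℝ := max |w.im| w.re

lemma abs_im_le_negAxisDist (w : ℂ) : |w.im| ≤ negAxisDist w := le_max_left _ _

lemma re_le_negAxisDist (w : ℂ) : w.re ≤ negAxisDist w := le_max_right _ _

lemma negAxisDist_le_norm (w : ℂ) : negAxisDist w ≤ ‖w‖ :=
  max_le (abs_im_le_norm w) (re_le_norm w)

lemma mem_slitPlane_of_negAxisDist_pos {w : ℂ} (hw : 0 < negAxisDist w) : w ∈ slitPlane :=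
  mem_slitPlane_iff.2 ((lt_max_iff.1 hw).symm.imp id abs_pos.1)

lemma ne_zero_of_negAxisDist_pos {w : ℂ} (hw : 0 < negAxisDist w) : w ≠ 0 :=
  slitPlane_ne_zero (mem_slitPlane_of_negAxisDist_pos hw)

lemma negAxisDist_sub_norm_le (w a : ℂ) : negAxisDist w - ‖a‖ ≤ negAxisDist (w + a) := by
  rw [sub_le_iff_le_add]
  refine max_le ?_ ?_
  · calc |w.im| = |(w + a).im - a.im| := by simp
      _ ≤ |(w + a).im| + |a.im| := abs_sub _ _
      _ ≤ negAxisDist (w + a) + ‖a‖ :=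
        add_le_add (abs_im_le_negAxisDist _) (abs_im_le_norm a)
  · calc w.re = (w + a).re + (-a).re := by simp
      _ ≤ negAxisDist (w + a) + ‖-a‖ := add_le_add (re_le_negAxisDist _) (re_le_norm _)
      _ = negAxisDist (w + a) + ‖a‖ := by rw [norm_neg]

lemma negAxisDist_le_add_natCast (w : ℂ) (k : ℕ) : negAxisDist w ≤ negAxisDist (w + k) :=
  max_le_max (by simp) (by simp)

lemma negAxisDist_div_natCast (w : ℂ) (n : ℕ) : negAxisDist (w / n) = negAxisDist w / n := by
  simp only [negAxisDist, div_natCast_im, div_natCast_re, abs_div, Nat.abs_cast]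
  exact max_div_div_right (α := ℝ) (Nat.cast_nonneg n) _ _

/-- The filter of points tending to infinity in distance from the negative real axis. -/
def awayFromNegAxis : Filter ℂ := comap negAxisDist atTop

lemma tendsto_negAxisDist : Tendsto negAxisDist awayFromNegAxis atTop := tendsto_comap

lemma tendsto_add_const_awayFromNegAxis (a : ℂ) :
    Tendsto (· + a) awayFromNegAxis awayFromNegAxis :=
  tendsto_comap_iff.2 <| tendsto_atTop_mono (negAxisDist_sub_norm_le · a) <|
    tendsto_atTop_add_const_right _ (-‖a‖) tendsto_negAxisDist

lemma tendsto_div_natCast_awayFromNegAxis {n : ℕ} (hn : 0 < n) :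
    Tendsto (fun w : ℂ => w / n) awayFromNegAxis awayFromNegAxis := by
  refine tendsto_comap_iff.2 ?_
  simp only [Function.comp_def, negAxisDist_div_natCast]
  exact tendsto_negAxisDist.atTop_div_const (by exact_mod_cast hn)

lemma tendsto_add_natCast_awayFromNegAxis (w : ℂ) :
    Tendsto (fun N : ℕ => w + N) atTop awayFromNegAxis := by
  refine tendsto_comap_iff.2 (tendsto_atTop_mono (fun N => re_le_negAxisDist (w + N)) ?_)
  simp only [add_re, natCast_re]
  exact tendsto_atTop_add_const_left _ _ tendsto_natCast_atTop_atTop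

/-- If `arg w + arg q` left `(-π, π]`, its sine, which has the sign of `im (w * q)`, would have the
sign opposite to `im w`. -/
lemma log_mul_of_re_pos {w q : ℂ} (hq : 0 < q.re) (hw : 0 < w.re ∨ 0 < w.im * (w * q).im) :
    log (w * q) = log w + log q := by
  have hw0 : w ≠ 0 := by rintro rfl; simp at hw
  have hq0 : q ≠ 0 := by rintro rfl; simp at hq
  refine (log_mul_eq_add_log_iff hw0 hq0).2 ?_
  have hargq := abs_lt.1 (abs_arg_lt_pi_div_two_iff.2 (Or.inl hq))
  rcases hw with hw | hw
  · have hargw := abs_lt.1 (abs_arg_lt_pi_div_two_iff.2 (Or.inl hw))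
    constructor <;> linarith
  have him : ‖w‖ * ‖q‖ * Real.sin (arg w + arg q) = (w * q).im := by
    rw [Real.sin_add, mul_im, ← norm_mul_cos_arg w, ← norm_mul_cos_arg q, ← norm_mul_sin_arg w,
      ← norm_mul_sin_arg q]
    ring
  have hnorm : 0 < ‖w‖ * ‖q‖ := by positivity
  have hargw := arg_mem_Ioc w
  rcases pos_and_pos_or_neg_and_neg_of_mul_pos hw with ⟨hw1, hwq⟩ | ⟨hw1, hwq⟩
  · have hargw0 : 0 ≤ arg w := arg_nonneg_iff.2 hw1.le
    refine ⟨by linarith, not_lt.1 fun hgt => ?_⟩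
    have hsin : Real.sin (arg w + arg q - 2 * Real.pi) < 0 :=
      Real.sin_neg_of_neg_of_neg_pi_lt (by linarith [hargw.2]) (by linarith)
    rw [Real.sin_sub_two_pi] at hsin
    exact (mul_neg_of_pos_of_neg hnorm hsin).not_gt (him ▸ hwq)
  · have hargw0 : arg w < 0 := arg_neg_iff.2 hw1
    refine ⟨not_le.1 fun hle => ?_, by linarith⟩
    have hsin : 0 ≤ Real.sin (arg w + arg q + 2 * Real.pi) :=
      Real.sin_nonneg_of_nonneg_of_le_pi (by linarith [hargw.1]) (by linarith)
    rw [Real.sin_add_two_pi] at hsin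
    exact (mul_nonneg hnorm.le hsin).not_gt (him ▸ hwq)

lemma log_add_eq_log_add_log_one_add {w a : ℂ} (ha : ‖a‖ < negAxisDist w) :
    log (w + a) = log w + log (1 + a / w) := by
  have hw0 := ne_zero_of_negAxisDist_pos ((norm_nonneg a).trans_lt ha)
  have hmul : w * (1 + a / w) = w + a := by field_simp
  rw [← hmul]
  refine log_mul_of_re_pos ?_ ?_
  · have hlt : ‖a / w‖ < 1 := by
      rw [norm_div, div_lt_one (norm_pos_iff.2 hw0)]
      exact ha.trans_le (negAxisDist_le_norm w)
    rw [add_re, one_re]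
    linarith [(abs_lt.1 ((abs_re_le_norm (a / w)).trans_lt hlt)).1]
  · rw [hmul, add_im]
    refine (lt_max_iff.1 ha).symm.imp ((norm_nonneg a).trans_lt ·) fun him => ?_
    have ha' := abs_le.1 (abs_im_le_norm a)
    rcases lt_abs.1 him with h | h
    · exact mul_pos (by linarith) (by linarith)
    · exact mul_pos_of_neg_of_neg (by linarith [norm_nonneg a]) (by linarith)

lemma eventually_log_add_natCast (a : ℂ) :
    ∀ᶠ N : ℕ in atTop, log (a + N) = Real.log N + log (1 + a / N) := by
  filter_upwards [tendsto_natCast_atTop_atTop.eventually_gt_atTop ‖a‖] with N hN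
  rw [add_comm, log_add_eq_log_add_log_one_add (hN.trans_le (re_le_negAxisDist (N : ℂ))),
    natCast_log]

/-- The terms of Gudermann's series for the remainder in Stirling's formula. -/
def gudermann (w : ℂ) : ℂ := (w + 1 / 2) * log (1 + 1 / w) - 1

/-- The terms of Gudermann's series without their main part `(1/w - 1/(w+1))/12`, whose sum
telescopes to `1/(12w)`. -/
def gudermannTail (w : ℂ) : ℂ := gudermann w - (1 / 12) * (1 / w - 1 / (w + 1))

lemma gudermannTail_inv {u : ℂ} (hu : u ≠ 0) (hu1 : 1 + u ≠ 0) :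
    gudermannTail u⁻¹ = u ^ 3 * (1 / 6) + u ^ 3 * (1 / 12 * (1 + u)⁻¹) +
      (u⁻¹ + 1 / 2) * (log (1 + u) - logTaylor 4 u) := by
  have htaylor : logTaylor 4 u = u - u ^ 2 / 2 + u ^ 3 / 3 := by
    simp [logTaylor_succ, logTaylor_zero]; ring
  have hshift : u⁻¹ + 1 = (1 + u) / u := by field_simp
  rw [gudermannTail, gudermann, htaylor, hshift]
  simp only [one_div, inv_inv, inv_div]
  field_simp
  ring

lemma norm_gudermannTail_le {w : ℂ} (hw : 2 ≤ ‖w‖) : ‖gudermannTail w‖ ≤ 1 / ‖w‖ ^ 3 := by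
  obtain ⟨u, rfl⟩ : ∃ u, w = u⁻¹ := ⟨w⁻¹, (inv_inv w).symm⟩
  have hu0 : u ≠ 0 := by rintro rfl; simp at hw; linarith
  have hupos : 0 < ‖u‖ := norm_pos_iff.2 hu0
  rw [norm_inv, le_inv_comm₀ two_pos hupos] at hw
  have hu1 : 1 / 2 ≤ ‖1 + u‖ := by
    have := norm_sub_norm_le (1 : ℂ) (-u)
    rw [norm_neg, norm_one, sub_neg_eq_add] at this
    linarith
  have hu1_inv : ‖1 + u‖⁻¹ ≤ 2 := inv_le_of_inv_le₀ two_pos (by linarith)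
  have hlog : ‖log (1 + u) - logTaylor 4 u‖ ≤ ‖u‖ ^ 4 / 2 := by
    refine (norm_log_sub_logTaylor_le 3 (z := u) (by linarith)).trans ?_
    have hinv : (1 - ‖u‖)⁻¹ ≤ 2 := inv_le_of_inv_le₀ two_pos (by linarith)
    calc ‖u‖ ^ (3 + 1) * (1 - ‖u‖)⁻¹ / ((3 : ℕ) + 1) ≤ ‖u‖ ^ (3 + 1) * 2 / ((3 : ℕ) + 1) := by
          gcongr
      _ = ‖u‖ ^ 4 / 2 := by norm_num; ring
  have hfactor : ‖u⁻¹ + 1 / 2‖ ≤ 5 / 4 * ‖u‖⁻¹ := by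
    have hinv : 2 ≤ ‖u‖⁻¹ := by rwa [le_inv_comm₀ two_pos hupos]
    have := norm_add_le u⁻¹ (1 / 2)
    rw [norm_inv, norm_div, norm_one, norm_ofNat] at this
    linarith
  rw [gudermannTail_inv hu0 (norm_pos_iff.1 (by linarith))]
  calc _ ≤ ‖u‖ ^ 3 * (1 / 6) + ‖u‖ ^ 3 * (1 / 12 * ‖1 + u‖⁻¹) +
        ‖u⁻¹ + 1 / 2‖ * ‖log (1 + u) - logTaylor 4 u‖ := by
        refine (norm_add₃_le ..).trans_eq ?_
        simp
    _ ≤ ‖u‖ ^ 3 * (1 / 6) + ‖u‖ ^ 3 * (1 / 12 * 2) + 5 / 4 * ‖u‖⁻¹ * (‖u‖ ^ 4 / 2) := by gcongr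
    _ = 23 / 24 * ‖u‖ ^ 3 := by field_simp; ring
    _ ≤ 1 / ‖u⁻¹‖ ^ 3 := by
      simp only [norm_inv, inv_pow, one_div, inv_inv]
      linarith [pow_pos hupos 3]

lemma one_div_sq_le_arctan_sub {D : ℝ} (hD : 1 ≤ D) (u : ℝ) :
    1 / (D + |u|) ^ 2 ≤ 2 / D * (Real.arctan ((u + 1) / D) - Real.arctan (u / D)) := by
  have hderiv (v : ℝ) :
      HasDerivAt (fun v => Real.arctan (v / D)) (1 / (1 + (v / D) ^ 2) * (1 / D)) v :=
    ((hasDerivAt_id v).div_const D).arctan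
  obtain ⟨v, hv, hslope⟩ := exists_hasDerivAt_eq_slope (fun v => Real.arctan (v / D)) _
    (lt_add_one u) (fun v _ => (hderiv v).continuousAt.continuousWithinAt) fun v _ => hderiv v
  rw [add_sub_cancel_left, div_one] at hslope
  have hvu : |v| ≤ |u| + 1 := by
    have hdist : |v - u| ≤ 1 := abs_le.2 ⟨by linarith [hv.1], by linarith [hv.2]⟩
    linarith [abs_sub_abs_le_abs_sub v u]
  rw [← hslope]
  have hvsq : v ^ 2 ≤ (|u| + 1) ^ 2 := by rw [← sq_abs v]; gcongr
  have hbound : D ^ 2 + v ^ 2 ≤ 2 * (D + |u|) ^ 2 := by nlinarith [abs_nonneg u]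
  calc 1 / (D + |u|) ^ 2 = 2 / (2 * (D + |u|) ^ 2) := by field_simp
    _ ≤ 2 / (D ^ 2 + v ^ 2) := by gcongr
    _ = 2 / D * (1 / (1 + (v / D) ^ 2) * (1 / D)) := by field_simp

lemma sum_range_one_div_sq_le {D : ℝ} (hD : 1 ≤ D) (x : ℝ) (N : ℕ) :
    ∑ k ∈ Finset.range N, 1 / (D + |x + k|) ^ 2 ≤ 2 * Real.pi / D := by
  have htelescope (k : ℕ) : 1 / (D + |x + k|) ^ 2 ≤ 2 / D *
      (Real.arctan ((x + (k + 1 : ℕ)) / D) - Real.arctan ((x + k) / D)) := by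
    simpa only [Nat.cast_succ, add_assoc] using one_div_sq_le_arctan_sub hD (x + k)
  refine (Finset.sum_le_sum fun k _ => htelescope k).trans ?_
  rw [← Finset.mul_sum, Finset.sum_range_sub (fun k : ℕ => Real.arctan ((x + k) / D)),
    mul_div_right_comm]
  gcongr
  linarith [Real.arctan_lt_pi_div_two ((x + N) / D),
    Real.neg_pi_div_two_lt_arctan ((x + (0 : ℕ)) / D)]

lemma sum_range_norm_gudermannTail_le {w : ℂ} (hw : 2 ≤ negAxisDist w) (N : ℕ) :
    ∑ k ∈ Finset.range N, ‖gudermannTail (w + k)‖ ≤ 16 * Real.pi / negAxisDist w ^ 2 := by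
  set D := negAxisDist w
  have hterm (k : ℕ) : ‖gudermannTail (w + k)‖ ≤ 8 / D * (1 / (D + |w.re + k|) ^ 2) := by
    have hD : D ≤ ‖w + k‖ := (negAxisDist_le_add_natCast w k).trans (negAxisDist_le_norm _)
    have hre : |w.re + k| ≤ ‖w + k‖ := by simpa using abs_re_le_norm (w + k)
    refine (norm_gudermannTail_le (hw.trans hD)).trans ?_
    calc 1 / ‖w + k‖ ^ 3 ≤ 1 / ((D + |w.re + k|) / 2) ^ 3 := by gcongr; linarith
      _ = 8 / (D + |w.re + k|) * (1 / (D + |w.re + k|) ^ 2) := by field_simp; norm_num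
      _ ≤ 8 / D * (1 / (D + |w.re + k|) ^ 2) := by
        gcongr; exact le_add_of_nonneg_right (abs_nonneg _)
  calc _ ≤ 8 / D * ∑ k ∈ Finset.range N, 1 / (D + |w.re + k|) ^ 2 := by
        rw [Finset.mul_sum]; exact Finset.sum_le_sum fun k _ => hterm k
    _ ≤ 8 / D * (2 * Real.pi / D) := by
        gcongr; exact sum_range_one_div_sq_le (by linarith) _ _
    _ = 16 * Real.pi / D ^ 2 := by ring

lemma summable_norm_gudermannTail {w : ℂ} (hw : 2 ≤ negAxisDist w) :
    Summable fun k : ℕ => ‖gudermannTail (w + k)‖ :=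
  summable_of_sum_range_le (fun _ => norm_nonneg _) (sum_range_norm_gudermannTail_le hw)

/-- The remainder `J` in Stirling's formula
`log Γ(w) = (w - 1/2) log w - w + log √(2π) + J(w)`. -/
def stirlingRemainder (w : ℂ) : ℂ := 1 / 12 * w⁻¹ + ∑' k : ℕ, gudermannTail (w + k)

lemma stirlingRemainder_sub_isBigO :
    (fun w => stirlingRemainder w - 1 / 12 * w⁻¹) =O[awayFromNegAxis]
      fun w => (negAxisDist w)⁻¹ ^ 2 := by
  refine IsBigO.of_bound (16 * Real.pi) ?_
  filter_upwards [tendsto_negAxisDist.eventually_ge_atTop 2] with w hw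
  rw [stirlingRemainder, add_sub_cancel_left, Real.norm_of_nonneg (by positivity), inv_pow,
    ← div_eq_mul_inv]
  exact (norm_tsum_le_tsum_norm (summable_norm_gudermannTail hw)).trans
    (Real.tsum_le_of_sum_range_le (fun _ => norm_nonneg _) (sum_range_norm_gudermannTail_le hw))

lemma inv_isBigO_inv_negAxisDist :
    (fun w : ℂ => w⁻¹) =O[awayFromNegAxis] fun w => (negAxisDist w)⁻¹ := by
  refine IsBigO.of_norm_eventuallyLE ?_
  filter_upwards [tendsto_negAxisDist.eventually_gt_atTop 0] with w hw
  rw [norm_inv]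
  exact inv_anti₀ hw (negAxisDist_le_norm w)

lemma tendsto_inv_negAxisDist : Tendsto (fun w => (negAxisDist w)⁻¹) awayFromNegAxis (𝓝 0) :=
  tendsto_negAxisDist.inv_tendsto_atTop

lemma tendsto_stirlingRemainder : Tendsto stirlingRemainder awayFromNegAxis (𝓝 0) := by
  have hsq : Tendsto (fun w => (negAxisDist w)⁻¹ ^ 2) awayFromNegAxis (𝓝 0) := by
    simpa using tendsto_inv_negAxisDist.pow 2
  have hinv := inv_isBigO_inv_negAxisDist.trans_tendsto tendsto_inv_negAxisDist
  have hsum := (stirlingRemainder_sub_isBigO.trans_tendsto hsq).add (hinv.const_mul (1 / 12))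
  rw [mul_zero, add_zero] at hsum
  exact hsum.congr fun w => sub_add_cancel _ _

lemma stirlingRemainder_sub_add_one {w : ℂ} (hw : 2 ≤ negAxisDist w) :
    stirlingRemainder w - stirlingRemainder (w + 1) = gudermann w := by
  have hsplit := (summable_norm_gudermannTail hw).of_norm.tsum_eq_zero_add
  have hshift (k : ℕ) : w + 1 + k = w + (k + 1 : ℕ) := by push_cast; ring
  simp only [stirlingRemainder, hshift]
  rw [hsplit, Nat.cast_zero, add_zero, gudermannTail]
  ring

/-- Stirling's approximation to the logarithm of the Gamma function, without the constant
`log √(2π)` but with the exact remainder. -/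
def stirlingLog (w : ℂ) : ℂ := (w - 1 / 2) * log w - w + stirlingRemainder w

lemma exp_stirlingLog_add_one {w : ℂ} (hw : 2 ≤ negAxisDist w) :
    exp (stirlingLog (w + 1)) = w * exp (stirlingLog w) := by
  have hlog : log (w + 1) = log w + log (1 + 1 / w) :=
    log_add_eq_log_add_log_one_add (by rw [norm_one]; linarith)
  have hrem := stirlingRemainder_sub_add_one hw
  rw [gudermann] at hrem
  have hstep : stirlingLog (w + 1) = log w + stirlingLog w := by
    rw [stirlingLog, stirlingLog, hlog]
    linear_combination -hrem
  rw [hstep, exp_add, exp_log (ne_zero_of_negAxisDist_pos (by linarith))]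

lemma exp_stirlingLog_add_natCast {w : ℂ} (hw : 2 ≤ negAxisDist w) (N : ℕ) :
    exp (stirlingLog (w + N)) = (∏ j ∈ Finset.range N, (w + j)) * exp (stirlingLog w) := by
  induction N with
  | zero => simp
  | succ N ih =>
    rw [Finset.prod_range_succ, Nat.cast_add, Nat.cast_one, ← add_assoc,
      exp_stirlingLog_add_one (hw.trans (negAxisDist_le_add_natCast w N)), ih]
    ring

lemma tendsto_stirlingLog_sub (w : ℂ) :
    Tendsto (fun N : ℕ => stirlingLog (w + (N + 1 : ℕ)) - (w + N + 1 / 2) * Real.log N + N)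
      atTop (𝓝 0) := by
  have hmain : Tendsto (fun N : ℕ => (N : ℂ) * log (1 + (w + 1) / N)) atTop (𝓝 (w + 1)) := by
    refine tendsto_nat_mul_log_one_add_of_tendsto (tendsto_const_nhds.congr' ?_)
    filter_upwards [eventually_ne_atTop 0] with N hN
    field_simp
  have hlog : Tendsto (fun N : ℕ => (w + 1 / 2) * log (1 + (w + 1) / N)) atTop (𝓝 0) := by
    have : Tendsto (fun N : ℕ => log (1 + (w + 1) / (N : ℂ))) atTop (𝓝 (log (1 + 0))) :=
      ((tendsto_const_div_atTop_nhds_zero_nat (w + 1)).const_add 1).clog (by simp)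
    simpa using this.const_mul (w + 1 / 2)
  have hrem := tendsto_stirlingRemainder.comp (tendsto_add_natCast_awayFromNegAxis (w + 1))
  have hsum := ((hmain.add hlog).sub_const (w + 1)).add hrem
  rw [add_zero, add_zero, sub_self] at hsum
  refine hsum.congr' ?_
  filter_upwards [eventually_log_add_natCast (w + 1)] with N hN
  have hcast : w + (N + 1 : ℕ) = w + 1 + N := by push_cast; ring
  rw [hcast, stirlingLog, hN, Function.comp_apply]
  ring

lemma factorial_eq_stirlingSeq_mul_exp {N : ℕ} (hN : 0 < N) :
    (N.factorial : ℂ) = (Stirling.stirlingSeq N * √2 : ℝ) *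
      exp ((N + 1 / 2) * Real.log N - N) := by
  have hN' : (0 : ℝ) < N := by exact_mod_cast hN
  have hexp : exp ((N + 1 / 2) * Real.log N - N) = ((√N * (N / Real.exp 1) ^ N : ℝ) : ℂ) := by
    rw [Real.sqrt_eq_rpow, Real.rpow_def_of_pos hN', div_pow, ← Real.exp_nat_mul,
      ← Real.exp_log (pow_pos hN' N), Real.log_pow, ← Real.exp_sub, ← Real.exp_add, ofReal_exp]
    congr 1
    push_cast
    ring
  rw [hexp, ← ofReal_mul, Stirling.stirlingSeq, ← ofReal_natCast, Real.sqrt_mul zero_le_two]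
  congr 1
  field_simp

/-- Both sides are limits: `Γ(w)` of Euler's sequence, the right-hand side by the functional
equation and Wallis' formula. -/
theorem Gamma_eq_exp_stirlingLog {w : ℂ} (hw : 2 ≤ negAxisDist w) :
    Gamma w = √(2 * Real.pi) * exp (stirlingLog w) := by
  refine tendsto_nhds_unique (GammaSeq_tendsto_Gamma w) ?_
  have hexp := (tendsto_stirlingLog_sub w).neg.cexp
  have hwallis : Tendsto (fun N => ((Stirling.stirlingSeq N * √2 : ℝ) : ℂ)) atTop
      (𝓝 ((√Real.pi * √2 : ℝ) : ℂ)) :=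
    (continuous_ofReal.tendsto _).comp (Stirling.tendsto_stirlingSeq_sqrt_pi.mul_const _)
  have hlim := (hwallis.mul hexp).mul_const (exp (stirlingLog w))
  rw [neg_zero, exp_zero, mul_one, ← Real.sqrt_mul Real.pi_nonneg, mul_comm Real.pi 2] at hlim
  refine hlim.congr' ?_
  filter_upwards [eventually_gt_atTop 0] with N hN
  have hprod : ∏ j ∈ Finset.range (N + 1), (w + (j : ℂ)) ≠ 0 :=
    Finset.prod_ne_zero_iff.2 fun j _ =>
      ne_zero_of_negAxisDist_pos (two_pos.trans_le (hw.trans (negAxisDist_le_add_natCast w j)))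
  rw [GammaSeq, factorial_eq_stirlingSeq_mul_exp hN, eq_div_iff hprod,
    cpow_def_of_ne_zero (Nat.cast_ne_zero.2 hN.ne'), mul_assoc, mul_comm (exp (stirlingLog w)),
    ← exp_stirlingLog_add_natCast hw, mul_assoc, ← exp_add, ← natCast_log, mul_left_comm,
    ← exp_add]
  congr 2
  ring

/-- The expansion `f w = b / w + O(1 / d(w)²)`, where `d(w)` is the distance of `w` from the
negative real axis. -/
def HasReciprocalExpansion (f : ℂ → ℂ) (b : ℂ) : Prop :=
  (fun w => f w - b * w⁻¹) =O[awayFromNegAxis] fun w => (negAxisDist w)⁻¹ ^ 2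

namespace HasReciprocalExpansion

variable {f g : ℂ → ℂ} {b b' : ℂ}

lemma add (hf : HasReciprocalExpansion f b) (hg : HasReciprocalExpansion g b') :
    HasReciprocalExpansion (fun w => f w + g w) (b + b') :=
  (IsBigO.add hf hg).congr_left fun w => by ring

lemma sub (hf : HasReciprocalExpansion f b) (hg : HasReciprocalExpansion g b') :
    HasReciprocalExpansion (fun w => f w - g w) (b - b') :=
  (IsBigO.sub hf hg).congr_left fun w => by ring

lemma sum {ι : Type*} {s : Finset ι} {f : ι → ℂ → ℂ} {b : ι → ℂ}
    (hf : ∀ i ∈ s, HasReciprocalExpansion (f i) (b i)) :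
    HasReciprocalExpansion (fun w => ∑ i ∈ s, f i w) (∑ i ∈ s, b i) :=
  (IsBigO.sum hf).congr_left fun w => by
    simp only [Finset.sum_apply, Finset.sum_sub_distrib, Finset.sum_mul]

lemma comp_add_const (hf : HasReciprocalExpansion f b) (c : ℂ) :
    HasReciprocalExpansion (fun w => f (w + c)) b := by
  have hshift : (fun w => (negAxisDist (w + c))⁻¹) =O[awayFromNegAxis]
      fun w => (negAxisDist w)⁻¹ := by
    refine IsBigO.of_bound 2 ?_
    filter_upwards [tendsto_negAxisDist.eventually_ge_atTop (2 * ‖c‖),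
      tendsto_negAxisDist.eventually_gt_atTop 0] with w hw hpos
    have hle : negAxisDist w / 2 ≤ negAxisDist (w + c) := by
      linarith [negAxisDist_sub_norm_le w c]
    rw [Real.norm_of_nonneg (inv_nonneg.2 (by linarith)), Real.norm_of_nonneg (by positivity)]
    calc (negAxisDist (w + c))⁻¹ ≤ (negAxisDist w / 2)⁻¹ := by gcongr
      _ = 2 * (negAxisDist w)⁻¹ := by rw [inv_div, div_eq_mul_inv]
  have hmain := (hf.comp_tendsto (tendsto_add_const_awayFromNegAxis c)).trans (hshift.pow 2)
  have hinv : (fun w => b * ((w + c)⁻¹ - w⁻¹)) =O[awayFromNegAxis]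
      fun w => (negAxisDist w)⁻¹ ^ 2 := by
    have hprod := ((inv_isBigO_inv_negAxisDist.comp_tendsto
      (tendsto_add_const_awayFromNegAxis c)).trans hshift).mul inv_isBigO_inv_negAxisDist
    simp only [← sq] at hprod
    refine (hprod.const_mul_left (-(b * c))).congr' ?_ EventuallyEq.rfl
    filter_upwards [tendsto_negAxisDist.eventually_gt_atTop ‖c‖] with w hw
    have hw0 : w ≠ 0 := ne_zero_of_negAxisDist_pos ((norm_nonneg c).trans_lt hw)
    have hwc : w + c ≠ 0 :=
      ne_zero_of_negAxisDist_pos ((sub_pos.2 hw).trans_le (negAxisDist_sub_norm_le w c))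
    simp only [Function.comp_apply]
    field_simp
    ring
  refine (IsBigO.add hmain hinv).congr_left fun w => ?_
  simp only [Function.comp_apply]
  ring

lemma comp_div_natCast (hf : HasReciprocalExpansion f b) {n : ℕ} (hn : 0 < n) :
    HasReciprocalExpansion (fun w => f (w / n)) (b * n) := by
  have hscale : (fun w => (negAxisDist (w / n))⁻¹) =O[awayFromNegAxis]
      fun w => (negAxisDist w)⁻¹ :=
    ((isBigO_refl _ _).const_mul_left (n : ℝ)).congr_left fun w => by
      rw [negAxisDist_div_natCast, inv_div, div_eq_mul_inv]
  refine ((hf.comp_tendsto (tendsto_div_natCast_awayFromNegAxis hn)).trans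
    (hscale.pow 2)).congr_left fun w => ?_
  rw [Function.comp_apply, inv_div, div_eq_mul_inv (n : ℂ), mul_assoc]

lemma isBigO_inv (hf : HasReciprocalExpansion f b) :
    f =O[awayFromNegAxis] fun w => (negAxisDist w)⁻¹ := by
  have hsq : (fun w => (negAxisDist w)⁻¹ ^ 2) =O[awayFromNegAxis] fun w => (negAxisDist w)⁻¹ := by
    simpa [sq] using (tendsto_inv_negAxisDist.isBigO_one ℝ).mul
      (isBigO_refl (fun w => (negAxisDist w)⁻¹) _)
  exact ((hf.trans hsq).add (inv_isBigO_inv_negAxisDist.const_mul_left b)).congr_left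
    fun w => sub_add_cancel _ _

lemma exp_sub_one (hf : HasReciprocalExpansion f b) :
    HasReciprocalExpansion (fun w => exp (f w) - 1) b := by
  have hlim : Tendsto f awayFromNegAxis (𝓝 0) :=
    hf.isBigO_inv.trans_tendsto tendsto_inv_negAxisDist
  have hexp : (fun w => exp (f w) - 1 - f w) =O[awayFromNegAxis] fun w => f w ^ 2 := by
    refine IsBigO.of_bound 1 ?_
    filter_upwards [hlim.norm.eventually_le_const (by simp : ‖(0 : ℂ)‖ < 1)] with w hw
    rw [norm_pow, one_mul]
    exact norm_exp_sub_one_sub_id_le hw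
  exact ((hexp.trans (hf.isBigO_inv.pow 2)).add hf).congr_left fun w => by ring

end HasReciprocalExpansion

lemma hasReciprocalExpansion_stirlingRemainder :
    HasReciprocalExpansion stirlingRemainder (1 / 12) :=
  stirlingRemainder_sub_isBigO

/-- The difference between the main terms of Stirling's formula for `log Γ(s + α)` and
`(s + α - 1/2) log s - s`. -/
def stirlingShift (α s : ℂ) : ℂ := (s + α - 1 / 2) * log (1 + α / s) - α

lemma hasReciprocalExpansion_stirlingShift (α : ℂ) :
    HasReciprocalExpansion (stirlingShift α) (α ^ 2 / 2 - α / 2) := by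
  have hdiv : (fun s : ℂ => α / s) =O[awayFromNegAxis] fun s => (negAxisDist s)⁻¹ :=
    inv_isBigO_inv_negAxisDist.const_mul_left α
  have hlog : (fun s : ℂ => log (1 + α / s) - logTaylor 3 (α / s)) =O[awayFromNegAxis]
      fun s => (α / s) ^ 3 :=
    (log_sub_logTaylor_isBigO 2).comp_tendsto (hdiv.trans_tendsto tendsto_inv_negAxisDist)
  have hfactor : (fun s : ℂ => s + (α - 1 / 2)) =O[awayFromNegAxis] fun s => s := by
    refine (isBigO_refl _ _).add (IsBigO.of_bound ‖α - 1 / 2‖ ?_)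
    filter_upwards [tendsto_negAxisDist.eventually_ge_atTop 1] with s hs
    exact le_mul_of_one_le_right (norm_nonneg _) (hs.trans (negAxisDist_le_norm s))
  have hne : ∀ᶠ s in awayFromNegAxis, s ≠ 0 :=
    (tendsto_negAxisDist.eventually_gt_atTop 0).mono fun s => ne_zero_of_negAxisDist_pos
  have herror : (fun s : ℂ => s * (α / s) ^ 3) =O[awayFromNegAxis]
      fun s => (negAxisDist s)⁻¹ ^ 2 :=
    ((hdiv.pow 2).const_mul_left α).congr'
      (hne.mono fun s hs => by field_simp) EventuallyEq.rfl
  refine (((hdiv.pow 2).const_mul_left (-((α - 1 / 2) / 2))).add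
    ((hfactor.mul hlog).trans herror)).congr' (hne.mono fun s hs => ?_) EventuallyEq.rfl
  have htaylor : logTaylor 3 (α / s) = α / s - (α / s) ^ 2 / 2 := by
    simp [logTaylor_succ, logTaylor_zero]; ring
  simp only [htaylor, stirlingShift]
  field_simp
  ring

/-- The logarithm of the ratio of `∏_a Γ(α_a + w/n)` to the main term given by Gauss's
multiplication formula. -/
def gammaRatioLog {n : ℕ} (α : Fin n → ℂ) (w : ℂ) : ℂ :=
  ∑ a, (stirlingShift (α a) (w / n) + stirlingRemainder (w / n + α a)) - stirlingRemainder w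

/-- The coefficient of `1/w` in the expansion of `gammaRatioLog α w`. -/
def gammaRatioCoeff {n : ℕ} (α : Fin n → ℂ) : ℂ :=
  ∑ a, ((α a ^ 2 / 2 - α a / 2) * n + 1 / 12 * n) - 1 / 12

lemma hasReciprocalExpansion_gammaRatioLog {n : ℕ} (hn : 0 < n) (α : Fin n → ℂ) :
    HasReciprocalExpansion (gammaRatioLog α) (gammaRatioCoeff α) :=
  .sub (.sum fun a _ => .add ((hasReciprocalExpansion_stirlingShift (α a)).comp_div_natCast hn)
      ((hasReciprocalExpansion_stirlingRemainder.comp_add_const (α a)).comp_div_natCast hn))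
    hasReciprocalExpansion_stirlingRemainder

/-- The constant `(2π)^{(n-1)/2} √n` of Gauss's multiplication formula. -/
def gaussConst (n : ℕ) : ℝ := √(2 * Real.pi) ^ n / √(2 * Real.pi) * √n

lemma Gamma_add_eq {α s : ℂ} (hs : ‖α‖ + 2 ≤ negAxisDist s) :
    Gamma (α + s) = √(2 * Real.pi) * exp (((s + α - 1 / 2) * log s - s) +
      (stirlingShift α s + stirlingRemainder (s + α))) := by
  rw [add_comm, Gamma_eq_exp_stirlingLog (by linarith [negAxisDist_sub_norm_le s α]), stirlingLog,
    log_add_eq_log_add_log_one_add (by linarith : ‖α‖ < negAxisDist s), stirlingShift]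
  congr 2
  ring

/-- Stirling's formula for all factors; the condition on `∑ a, α a` makes the powers of `w` on both
sides agree. -/
lemma eventually_prod_Gamma_eq {n : ℕ} (hn : 0 < n) {α : Fin n → ℂ}
    (hα : ∑ a, α a = ((n : ℂ) - 1) / 2) :
    ∀ᶠ w in awayFromNegAxis, ∏ a, Gamma (α a + w / n) =
      gaussConst n * exp (-(w * Real.log n)) * Gamma w * exp (gammaRatioLog α w) := by
  have hn' : (0 : ℝ) < n := by exact_mod_cast hn
  have hn0 : (n : ℂ) ≠ 0 := by exact_mod_cast hn.ne'
  have hfactors : ∀ᶠ w in awayFromNegAxis, ∀ a, ‖α a‖ + 2 ≤ negAxisDist (w / n) :=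
    eventually_all.2 fun a =>
      (tendsto_negAxisDist.comp (tendsto_div_natCast_awayFromNegAxis hn)).eventually_ge_atTop _
  filter_upwards [hfactors, tendsto_negAxisDist.eventually_ge_atTop 2] with w hw hw2
  have hw0 : w ≠ 0 := ne_zero_of_negAxisDist_pos (two_pos.trans_le hw2)
  have hlog : log w = log (w / n) + Real.log n := by
    rw [add_comm, ← log_ofReal_mul hn' (div_ne_zero hw0 hn0), ofReal_natCast,
      mul_div_cancel₀ _ hn0]
  have hsum : ∑ a, ((w / n + α a - 1 / 2) * log (w / n) - w / n) =
      (w - 1 / 2) * log (w / n) - w := by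
    simp only [Finset.sum_sub_distrib, ← Finset.sum_mul, Finset.sum_add_distrib, hα,
      Finset.sum_const, Finset.card_univ, Fintype.card_fin, nsmul_eq_mul]
    field_simp
    ring
  have hsqrt : ((√n : ℝ) : ℂ) = exp (Real.log n / 2) := by
    rw [Real.sqrt_eq_rpow, Real.rpow_def_of_pos hn', ofReal_exp]
    congr 1; push_cast; ring
  have hpi : ((√(2 * Real.pi) : ℝ) : ℂ) ≠ 0 := by rw [ofReal_ne_zero]; positivity
  have hexponent (Q : ℂ) : (w - 1 / 2) * log (w / n) - w + Q = Real.log n / 2 +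
      -(w * Real.log n) + ((w - 1 / 2) * (log (w / n) + Real.log n) - w + stirlingRemainder w) +
      (Q - stirlingRemainder w) := by ring
  rw [Finset.prod_congr rfl fun a _ => Gamma_add_eq (hw a), Finset.prod_mul_distrib, ← exp_sum,
    Finset.sum_add_distrib, hsum, Finset.prod_const, Finset.card_univ, Fintype.card_fin,
    Gamma_eq_exp_stirlingLog hw2, stirlingLog, hlog, gammaRatioLog, gaussConst, hexponent]
  simp only [exp_add, ofReal_mul, ofReal_div, ofReal_pow, hsqrt]
  field_simp

/-- The second order term is `b Γ(w - 1)` with `b` a constant, rather than `(b / w) Γ(w)`, because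
the residue sums of `Γ(w - 1)` are elementary. -/
lemma prod_Gamma_sub_isBigO {n : ℕ} (hn : 0 < n) {α : Fin n → ℂ}
    (hα : ∑ a, α a = ((n : ℂ) - 1) / 2) :
    (fun w => ∏ a, Gamma (α a + w / n) - gaussConst n * exp (-(w * Real.log n)) *
      (Gamma w + gammaRatioCoeff α * Gamma (w - 1))) =O[awayFromNegAxis]
      fun w => exp (-(w * Real.log n)) * Gamma w * ((negAxisDist w)⁻¹ ^ 2 : ℝ) := by
  have hinv : HasReciprocalExpansion (fun w => gammaRatioCoeff α * (w - 1)⁻¹) (gammaRatioCoeff α) :=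
    HasReciprocalExpansion.comp_add_const (f := fun w => gammaRatioCoeff α * w⁻¹)
      ((isBigO_zero _ _).congr_left fun w => (sub_self _).symm) (-1)
  have hratio := (hasReciprocalExpansion_gammaRatioLog hn α).exp_sub_one.sub hinv
  rw [sub_self] at hratio
  have hratio' : (fun w => exp (gammaRatioLog α w) - 1 - gammaRatioCoeff α * (w - 1)⁻¹)
      =O[awayFromNegAxis] fun w => (((negAxisDist w)⁻¹ ^ 2 : ℝ) : ℂ) :=
    isBigO_ofReal_right.2 (hratio.congr_left fun w => by ring)
  refine (((isBigO_refl (fun w => exp (-(w * Real.log n)) * Gamma w) _).const_mul_left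
    (gaussConst n)).mul hratio').congr' ?_ EventuallyEq.rfl
  filter_upwards [eventually_prod_Gamma_eq hn hα, tendsto_negAxisDist.eventually_gt_atTop 1]
    with w hw hw1
  have hw0 : w - 1 ≠ 0 := by
    rw [sub_eq_add_neg]
    refine ne_zero_of_negAxisDist_pos (lt_of_lt_of_le ?_ (negAxisDist_sub_norm_le w (-1)))
    simpa using hw1
  have hGamma : Gamma w = (w - 1) * Gamma (w - 1) := by
    rw [← Gamma_add_one _ hw0, sub_add_cancel]
  rw [hw, hGamma]
  field_simp
  ring

/-- The integrand `e^{-ℓw} ∏_a Γ(α_a + w/n)` of the Mellin–Barnes integrals. -/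
def gammaKernel {n : ℕ} (α : Fin n → ℂ) (ℓ w : ℂ) : ℂ :=
  exp (-(ℓ * w)) * ∏ a, Gamma (α a + w / n)

/-- The exponent `Re (w log w - w - ℓw)` of the function `|e^{-ℓw} Γ(w)|`. -/
def gammaExponent (ℓ w : ℂ) : ℝ := (w * log w - w - ℓ * w).re

lemma exists_norm_exp_mul_Gamma_le :
    ∃ C : ℝ, 0 < C ∧ ∀ᶠ w in awayFromNegAxis, ∀ ℓ : ℂ,
      ‖exp (-(ℓ * w)) * Gamma w‖ ≤ C * Real.exp (gammaExponent ℓ w) := by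
  refine ⟨√(2 * Real.pi) * Real.exp 1, by positivity, ?_⟩
  filter_upwards [tendsto_negAxisDist.eventually_ge_atTop 2,
    tendsto_stirlingRemainder.norm.eventually_le_const (by simp : ‖(0 : ℂ)‖ < 1)] with w hw hrem ℓ
  have hfactors : exp (-(ℓ * w)) * Gamma w = √(2 * Real.pi) *
      exp ((stirlingRemainder w - log w / 2) + (w * log w - w - ℓ * w)) := by
    rw [Gamma_eq_exp_stirlingLog hw, stirlingLog, mul_left_comm, ← exp_add]
    congr 2; ring
  have hlog : 0 ≤ (log w / 2).re := by
    rw [show log w / 2 = ((1 / 2 : ℝ) : ℂ) * log w by push_cast; ring, re_ofReal_mul, log_re]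
    have := Real.log_nonneg (by linarith [negAxisDist_le_norm w] : 1 ≤ ‖w‖)
    positivity
  have hre : (stirlingRemainder w - log w / 2).re ≤ 1 := by
    rw [sub_re]
    linarith [(re_le_norm _).trans hrem]
  rw [hfactors, norm_mul, norm_exp, norm_real, Real.norm_of_nonneg (Real.sqrt_nonneg _), add_re,
    Real.exp_add, mul_assoc, ← gammaExponent]
  gcongr

/-- The integral of `f` over the lower, right and upper sides of the rectangle
`[a, c] × [-Y, Y]`, taken counterclockwise. -/
def threeSideIntegral (f : ℂ → ℂ) (a c Y : ℝ) : ℂ :=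
  (∫ x : ℝ in a..c, f (x + (-Y : ℝ) * I)) - (∫ x : ℝ in a..c, f (x + Y * I)) +
    I * ∫ y : ℝ in -Y..Y, f (c + y * I)

/-- The integral of `f` over the left side of the rectangle `[a, c] × [-Y, Y]`, upwards. -/
def leftSideIntegral (f : ℂ → ℂ) (a Y : ℝ) : ℂ := I * ∫ y : ℝ in -Y..Y, f (a + y * I)

/-- The integral of `f` over the boundary of the rectangle `[a, c] × [-Y, Y]`. -/
def rectIntegral (f : ℂ → ℂ) (a c Y : ℝ) : ℂ := threeSideIntegral f a c Y - leftSideIntegral f a Y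

/-- The boundary of the rectangle `[a, c] × [-Y, Y]`. -/
def rectFrame (a c Y : ℝ) : Set ℂ := (Icc a c ×ℂ Icc (-Y) Y) \ (Ioo a c ×ℂ Ioo (-Y) Y)

section Rectangle

variable {a c Y : ℝ} {f g : ℂ → ℂ}

lemma horizontal_mem_rectFrame {x y : ℝ} (hx : x ∈ Icc a c) (hy : |y| = Y) :
    (x : ℂ) + y * I ∈ rectFrame a c Y := by
  refine ⟨⟨by simpa using hx, by simpa using abs_le.1 hy.le⟩, fun h => ?_⟩
  have hy' : -Y < y ∧ y < Y := by simpa using h.2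
  exact (abs_lt.2 hy').ne hy

lemma vertical_mem_rectFrame {x y : ℝ} (hac : a ≤ c) (hx : x = a ∨ x = c) (hy : y ∈ Icc (-Y) Y) :
    (x : ℂ) + y * I ∈ rectFrame a c Y := by
  rcases hx with rfl | rfl <;> simp_all [rectFrame, mem_reProdIm]

lemma intervalIntegrable_horizontal (hf : ContinuousOn f (rectFrame a c Y)) (hac : a ≤ c) {y : ℝ}
    (hy : |y| = Y) : IntervalIntegrable (fun x : ℝ => f (x + y * I)) MeasureTheory.volume a c := by
  apply ContinuousOn.intervalIntegrable
  rw [uIcc_of_le hac]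
  exact hf.comp (by fun_prop) fun x hx => horizontal_mem_rectFrame hx hy

lemma intervalIntegrable_vertical (hf : ContinuousOn f (rectFrame a c Y)) (hac : a ≤ c)
    (hY : 0 ≤ Y) {x : ℝ} (hx : x = a ∨ x = c) :
    IntervalIntegrable (fun y : ℝ => f (x + y * I)) MeasureTheory.volume (-Y) Y := by
  apply ContinuousOn.intervalIntegrable
  rw [uIcc_of_le (neg_le_self hY)]
  exact hf.comp (by fun_prop) fun y hy => vertical_mem_rectFrame hac hx hy

lemma threeSideIntegral_sub (hf : ContinuousOn f (rectFrame a c Y))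
    (hg : ContinuousOn g (rectFrame a c Y)) (hac : a ≤ c) (hY : 0 ≤ Y) :
    threeSideIntegral (fun w => f w - g w) a c Y =
      threeSideIntegral f a c Y - threeSideIntegral g a c Y := by
  have hlow : |(-Y)| = Y := by rw [abs_neg, abs_of_nonneg hY]
  have hup : |Y| = Y := abs_of_nonneg hY
  simp only [threeSideIntegral]
  rw [intervalIntegral.integral_sub (intervalIntegrable_horizontal hf hac hlow)
      (intervalIntegrable_horizontal hg hac hlow),
    intervalIntegral.integral_sub (intervalIntegrable_horizontal hf hac hup)
      (intervalIntegrable_horizontal hg hac hup),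
    intervalIntegral.integral_sub (intervalIntegrable_vertical hf hac hY (.inr rfl))
      (intervalIntegrable_vertical hg hac hY (.inr rfl))]
  ring

lemma rectIntegral_sub (hf : ContinuousOn f (rectFrame a c Y))
    (hg : ContinuousOn g (rectFrame a c Y)) (hac : a ≤ c) (hY : 0 ≤ Y) :
    rectIntegral (fun w => f w - g w) a c Y = rectIntegral f a c Y - rectIntegral g a c Y := by
  simp only [rectIntegral, threeSideIntegral_sub hf hg hac hY, leftSideIntegral]
  rw [intervalIntegral.integral_sub (intervalIntegrable_vertical hf hac hY (.inl rfl))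
    (intervalIntegrable_vertical hg hac hY (.inl rfl))]
  ring

lemma threeSideIntegral_const_mul (f : ℂ → ℂ) (k : ℂ) :
    threeSideIntegral (fun w => k * f w) a c Y = k * threeSideIntegral f a c Y := by
  simp only [threeSideIntegral, intervalIntegral.integral_const_mul]
  ring

lemma rectIntegral_const_mul (f : ℂ → ℂ) (k : ℂ) :
    rectIntegral (fun w => k * f w) a c Y = k * rectIntegral f a c Y := by
  simp only [rectIntegral, threeSideIntegral_const_mul, leftSideIntegral,
    intervalIntegral.integral_const_mul]
  ring

lemma rectIntegral_congr (h : EqOn f g (rectFrame a c Y)) (hac : a ≤ c) (hY : 0 ≤ Y) :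
    rectIntegral f a c Y = rectIntegral g a c Y := by
  have horizontal {y : ℝ} (hy : |y| = Y) :
      ∫ x : ℝ in a..c, f (x + y * I) = ∫ x : ℝ in a..c, g (x + y * I) :=
    intervalIntegral.integral_congr fun x hx =>
      h (horizontal_mem_rectFrame (by rwa [uIcc_of_le hac] at hx) hy)
  have vertical {x : ℝ} (hx : x = a ∨ x = c) :
      ∫ y : ℝ in -Y..Y, f (x + y * I) = ∫ y : ℝ in -Y..Y, g (x + y * I) :=
    intervalIntegral.integral_congr fun y hy =>
      h (vertical_mem_rectFrame hac hx (by rwa [uIcc_of_le (neg_le_self hY)] at hy))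
  simp only [rectIntegral, threeSideIntegral, leftSideIntegral,
    horizontal (abs_of_nonneg hY), horizontal ((abs_neg Y).trans (abs_of_nonneg hY)),
    vertical (.inl rfl), vertical (.inr rfl)]

lemma rectIntegral_eq_zero (hac : a ≤ c) (hY : 0 ≤ Y)
    (hf : DifferentiableOn ℂ f (Icc a c ×ℂ Icc (-Y) Y)) : rectIntegral f a c Y = 0 := by
  have hzero := integral_boundary_rect_eq_zero_of_differentiableOn f (a + (-Y : ℝ) * I)
    (c + Y * I) (by simpa [uIcc_of_le hac, uIcc_of_le (neg_le_self hY)] using hf)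
  simpa [rectIntegral, threeSideIntegral, leftSideIntegral] using! hzero

lemma mul_integral_inv_eq_log_sub_log {γ : ℝ → ℂ} {d : ℂ} (hγ : ∀ t, HasDerivAt γ d t)
    (hslit : ∀ t, γ t ∈ slitPlane) (u v : ℝ) :
    d * ∫ t in u..v, (γ t)⁻¹ = log (γ v) - log (γ u) := by
  have hcont : Continuous γ := continuous_iff_continuousAt.2 fun t => (hγ t).continuousAt
  rw [← intervalIntegral.integral_const_mul]
  refine intervalIntegral.integral_eq_sub_of_hasDerivAt (f := fun t => log (γ t)) (fun t _ => ?_)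
    (Continuous.intervalIntegrable ?_ _ _)
  · simpa only [div_eq_mul_inv] using (hγ t).clog_real (hslit t)
  · exact continuous_const.mul (hcont.inv₀ fun t => slitPlane_ne_zero (hslit t))

lemma rectIntegral_inv_sub {p : ℂ} (hp : p ∈ Ioo a c ×ℂ Ioo (-Y) Y) :
    rectIntegral (fun w => (w - p)⁻¹) a c Y = 2 * Real.pi * I := by
  obtain ⟨⟨hap, hpc⟩, hYp, hpY⟩ := hp
  have horizontal {y : ℝ} (hy : y ≠ p.im) := mul_integral_inv_eq_log_sub_log (d := 1)
    (γ := fun x => (x : ℂ) + y * I - p)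
    (fun x => ((hasDerivAt_id x).ofReal_comp.add_const _).sub_const p)
    (fun x => .inr (by simpa using sub_ne_zero.2 hy)) a c
  have vertical (x y : ℝ) : HasDerivAt (fun y : ℝ => (x : ℂ) + y * I - p) I y := by
    simpa using (((hasDerivAt_id y).ofReal_comp.mul_const I).const_add (x : ℂ)).sub_const p
  have right := mul_integral_inv_eq_log_sub_log (vertical c)
    (fun y => .inl (by simpa using hpc)) (-Y) Y
  have left := mul_integral_inv_eq_log_sub_log (fun y => (vertical a y).fun_neg)
    (fun y => .inl (by simpa using hap)) (-Y) Y
  simp only [inv_neg, intervalIntegral.integral_neg, neg_mul_neg] at left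
  have hlogup : log (-((a : ℂ) + Y * I - p)) = log (a + Y * I - p) - Real.pi * I := by
    rw [log, log, norm_neg, arg_neg_eq_arg_sub_pi_of_im_pos (by simpa using hpY)]
    push_cast; ring
  have hloglow : log (-((a : ℂ) + (-Y : ℝ) * I - p)) =
      log (a + (-Y : ℝ) * I - p) + Real.pi * I := by
    rw [log, log, norm_neg, arg_neg_eq_arg_add_pi_of_im_neg (by simpa using hYp)]
    push_cast; ring
  have low := horizontal hYp.ne
  have up := horizontal hpY.ne'
  rw [one_mul] at low up
  rw [rectIntegral, threeSideIntegral, leftSideIntegral, low, up, right, left, hlogup, hloglow]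
  ring

end Rectangle

lemma exists_differentiableOn_sub_simplePole {U : Set ℂ} {f : ℂ → ℂ} {p r : ℂ} (hU : U ∈ 𝓝 p)
    (hf : DifferentiableOn ℂ f (U \ {p}))
    (hr : Tendsto (fun w => (w - p) * f w) (𝓝[≠] p) (𝓝 r)) :
    ∃ F, DifferentiableOn ℂ F U ∧ ∀ w ≠ p, F w = f w - r * (w - p)⁻¹ := by
  set f₁ : ℂ → ℂ := fun w => f w - r * (w - p)⁻¹ with hf₁
  have hne : ∀ᶠ w in 𝓝[≠] p, w - p ≠ 0 :=
    eventually_mem_nhdsWithin.mono fun w hw => sub_ne_zero.2 hw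
  have hdiff : DifferentiableOn ℂ f₁ (U \ {p}) := by
    refine hf.sub fun w hw => ?_
    have hwp : w - p ≠ 0 := sub_ne_zero.2 hw.2
    fun_prop (disch := assumption)
  have hlittle : (fun w => f₁ w - f₁ p) =o[𝓝[≠] p] fun w => (w - p)⁻¹ := by
    rw [isLittleO_iff_tendsto' (hne.mono fun w hw h => absurd (inv_eq_zero.1 h) hw)]
    have hsub : Tendsto (fun w => w - p) (𝓝[≠] p) (𝓝 0) :=
      (sub_self p ▸ tendsto_id.sub_const p : Tendsto _ (𝓝 p) _).mono_left nhdsWithin_le_nhds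
    have hlim := (hr.sub_const r).sub (hsub.mul_const (f₁ p))
    simp only [sub_self, zero_mul] at hlim
    refine hlim.congr' (hne.mono fun w hw => ?_)
    simp only [hf₁]
    field_simp
  exact ⟨Function.update f₁ p (limUnder (𝓝[≠] p) f₁),
    differentiableOn_update_limUnder_of_isLittleO hU hdiff hlittle,
    fun w hw => Function.update_of_ne hw _ _⟩

lemma tendsto_sub_mul_nhdsNE_zero {f : ℂ → ℂ} {p : ℂ} (hf : ContinuousAt f p) :
    Tendsto (fun w => (w - p) * f w) (𝓝[≠] p) (𝓝 0) := by
  have hlim := (tendsto_id.sub_const p).mul hf.tendsto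
  simp only [id_eq, sub_self, zero_mul] at hlim
  exact hlim.mono_left nhdsWithin_le_nhds

lemma rectIntegral_eq_add_residue {a c Y : ℝ} {f F : ℂ → ℂ} {p r : ℂ} (hac : a ≤ c) (hY : 0 ≤ Y)
    (hp : p ∈ Ioo a c ×ℂ Ioo (-Y) Y) (hf : ContinuousOn f (rectFrame a c Y))
    (hF : ∀ w ≠ p, F w = f w - r * (w - p)⁻¹) :
    rectIntegral f a c Y = rectIntegral F a c Y + 2 * Real.pi * I * r := by
  have hne : ∀ w ∈ rectFrame a c Y, w ≠ p := fun w hw h => hw.2 (h ▸ hp)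
  have hinv : ContinuousOn (fun w => r * (w - p)⁻¹) (rectFrame a c Y) := fun w hw => by
    have : w - p ≠ 0 := sub_ne_zero.2 (hne w hw)
    fun_prop (disch := assumption)
  have hsplit := rectIntegral_congr (f := F) (fun w hw => hF w (hne w hw)) hac hY
  rw [rectIntegral_sub hf hinv hac hY, rectIntegral_const_mul, rectIntegral_inv_sub hp] at hsplit
  linear_combination -hsplit

theorem rectIntegral_eq_sum_residues {a c Y : ℝ} {ι : Type*} (S : Finset ι) {p r : ι → ℂ}
    (hac : a ≤ c) (hY : 0 ≤ Y) (hp : Function.Injective p)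
    (hS : ∀ i ∈ S, p i ∈ Ioo a c ×ℂ Ioo (-Y) Y) {f : ℂ → ℂ}
    (hf : DifferentiableOn ℂ f ((Icc a c ×ℂ Icc (-Y) Y) \ p '' S))
    (hr : ∀ i ∈ S, Tendsto (fun w => (w - p i) * f w) (𝓝[≠] p i) (𝓝 (r i))) :
    rectIntegral f a c Y = 2 * Real.pi * I * ∑ i ∈ S, r i := by
  classical
  induction S using Finset.induction_on generalizing f with
  | empty =>
    rw [Finset.sum_empty, mul_zero]
    exact rectIntegral_eq_zero hac hY (by simpa using hf)
  | insert i S hi ih =>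
    have hiS : p i ∈ Ioo a c ×ℂ Ioo (-Y) Y := hS i (Finset.mem_insert_self i S)
    have hnhds : (Icc a c ×ℂ Icc (-Y) Y) \ p '' S ∈ 𝓝 (p i) :=
      inter_mem (mem_of_superset ((isOpen_Ioo.reProdIm isOpen_Ioo).mem_nhds hiS)
        (reProdIm_subset_iff.2 (prod_mono Ioo_subset_Icc_self Ioo_subset_Icc_self)))
        ((S.finite_toSet.image p).isClosed.isOpen_compl.mem_nhds
          fun ⟨j, hj, hji⟩ => hi (hp hji ▸ hj))
    rw [Finset.coe_insert, image_insert_eq] at hf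
    obtain ⟨F, hF, hFf⟩ := exists_differentiableOn_sub_simplePole hnhds
      (hf.mono (by rw [sdiff_sdiff, union_singleton])) (hr i (Finset.mem_insert_self i S))
    have hres : ∀ j ∈ S, Tendsto (fun w => (w - p j) * F w) (𝓝[≠] p j) (𝓝 (r j)) := by
      intro j hj
      have hji : p j ≠ p i := fun h => hi (hp h ▸ hj)
      have hcont : ContinuousAt (fun w => r i * (w - p i)⁻¹) (p j) := by
        have : p j - p i ≠ 0 := sub_ne_zero.2 hji
        fun_prop (disch := assumption)
      have hlim := (hr j (Finset.mem_insert_of_mem hj)).sub (tendsto_sub_mul_nhdsNE_zero hcont)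
      rw [sub_zero] at hlim
      refine hlim.congr' ?_
      filter_upwards [mem_nhdsWithin_of_mem_nhds (isOpen_compl_singleton.mem_nhds hji)] with w hw
      rw [hFf w hw, mul_sub]
    have hcont : ContinuousOn f (rectFrame a c Y) := hf.continuousOn.mono fun w hw =>
      ⟨hw.1, by
        rw [← image_insert_eq, ← Finset.coe_insert]
        exact fun ⟨j, hj, hjw⟩ => hw.2 (hjw ▸ hS j hj)⟩
    rw [rectIntegral_eq_add_residue hac hY hiS hcont hFf, Finset.sum_insert hi,
      ih (fun j hj => hS j (Finset.mem_insert_of_mem hj)) hF hres]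
    ring

lemma tendsto_add_natCast_mul_Gamma (m : ℕ) :
    Tendsto (fun s => (s + m) * Gamma s) (𝓝[≠] (-m : ℂ)) (𝓝 ((-1) ^ m / m.factorial)) := by
  induction m with
  | zero => simpa using tendsto_self_mul_Gamma_nhds_zero
  | succ m ih =>
    have hm : (-(m + 1 : ℕ) : ℂ) ≠ 0 := neg_ne_zero.2 (Nat.cast_ne_zero.2 m.succ_ne_zero)
    have hshift : Tendsto (fun s : ℂ => s + 1) (𝓝[≠] (-(m + 1 : ℕ) : ℂ)) (𝓝[≠] (-m : ℂ)) := by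
      have hderiv := (hasDerivAt_id (-(m + 1 : ℕ) : ℂ)).add_const 1
      simpa using hderiv.tendsto_nhdsNE one_ne_zero
    have hlim := (ih.comp hshift).mul ((tendsto_inv₀ hm).mono_left nhdsWithin_le_nhds)
    have hvalue : (-1 : ℂ) ^ (m + 1) / (m + 1).factorial =
        (-1) ^ m / m.factorial * (-(m + 1 : ℕ) : ℂ)⁻¹ := by
      rw [Nat.factorial_succ, pow_succ, inv_neg, Nat.cast_mul]
      ring
    rw [hvalue]
    refine hlim.congr' ?_
    filter_upwards [mem_nhdsWithin_of_mem_nhds (isOpen_compl_singleton.mem_nhds hm)] with s hs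
    have hs0 : s ≠ 0 := hs
    simp only [Function.comp_apply, Gamma_add_one s hs0]
    push_cast
    field_simp
    ring

section GammaKernel

variable {n : ℕ} {α : Fin n → ℂ} {ℓ : ℂ}

/-- The pole of `∏_a Γ(α_a + w/n)` at which `α_J + w/n = -k`. -/
def gammaPole (α : Fin n → ℂ) (J : Fin n) (k : ℕ) : ℂ := -(n * (α J + k))

/-- The residue of `gammaKernel α ℓ` at `gammaPole α J k`, when the `α_a` are pairwise
incongruent modulo `ℤ`. -/
def gammaResidue (α : Fin n → ℂ) (ℓ : ℂ) (J : Fin n) (k : ℕ) : ℂ :=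
  n * ((-1) ^ k / k.factorial) * exp (ℓ * (n * (α J + k))) *
    ∏ a ∈ Finset.univ.erase J, Gamma (α a - α J - k)

lemma gammaPole_div (hn : 0 < n) (J : Fin n) (k : ℕ) : gammaPole α J k / n = -(α J + k) := by
  rw [gammaPole, neg_div, mul_div_cancel_left₀ _ (Nat.cast_ne_zero.2 hn.ne')]

lemma gammaPole_re (J : Fin n) (k : ℕ) : (gammaPole α J k).re = -(n * ((α J).re + k)) := by
  simp [gammaPole]

lemma gammaPole_im (J : Fin n) (k : ℕ) : (gammaPole α J k).im = -(n * (α J).im) := by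
  simp [gammaPole]

lemma gammaPole_injective (hn : 0 < n) (hα : ∀ a b, a ≠ b → ∀ k : ℤ, α a - α b ≠ k) :
    Function.Injective fun i : (_ : Fin n) × ℕ => gammaPole α i.1 i.2 := by
  rintro ⟨J, k⟩ ⟨J', k'⟩ h
  have hadd : α J + k = α J' + k' := by
    simpa [gammaPole, hn.ne'] using h
  obtain rfl : J = J' := by
    by_contra hne
    refine hα J J' hne (k' - k) ?_
    push_cast
    linear_combination hadd
  rw [Nat.cast_injective (add_left_cancel hadd)]

lemma differentiableAt_gammaKernel (hn : 0 < n) {w : ℂ} (hw : ∀ J k, w ≠ gammaPole α J k) :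
    DifferentiableAt ℂ (gammaKernel α ℓ) w := by
  have hn0 : (n : ℂ) ≠ 0 := Nat.cast_ne_zero.2 hn.ne'
  unfold gammaKernel
  refine DifferentiableAt.mul (by fun_prop) (DifferentiableAt.fun_finsetProd fun a _ => ?_)
  have hGamma : DifferentiableAt ℂ Gamma (α a + w / n) := by
    refine differentiableAt_Gamma _ fun m h => hw a m ?_
    rw [gammaPole]
    field_simp at h
    linear_combination h
  exact hGamma.comp (f := fun w => α a + w / n) w (by fun_prop)

lemma tendsto_sub_gammaPole_mul_gammaKernel (hn : 0 < n)
    (hα : ∀ a b, a ≠ b → ∀ k : ℤ, α a - α b ≠ k) (J : Fin n) (k : ℕ) :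
    Tendsto (fun w => (w - gammaPole α J k) * gammaKernel α ℓ w) (𝓝[≠] gammaPole α J k)
      (𝓝 (gammaResidue α ℓ J k)) := by
  have hn0 : (n : ℂ) ≠ 0 := Nat.cast_ne_zero.2 hn.ne'
  set p := gammaPole α J k with hp
  have harg (a : Fin n) : α a + p / n = α a - α J - k := by rw [hp, gammaPole_div hn]; ring
  have hderiv (a : Fin n) : HasDerivAt (fun w : ℂ => α a + w / n) (1 / n) p :=
    ((hasDerivAt_id p).div_const _).const_add _
  have hpole : Tendsto (fun w : ℂ => α J + w / n) (𝓝[≠] p) (𝓝[≠] (-k : ℂ)) := by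
    simpa [harg] using (hderiv J).tendsto_nhdsNE (one_div_ne_zero hn0)
  have hregular : ∀ a ∈ Finset.univ.erase J, Tendsto (fun w : ℂ => Gamma (α a + w / n)) (𝓝[≠] p)
      (𝓝 (Gamma (α a - α J - k))) := fun a ha => by
    rw [← harg]
    have hGamma : ContinuousAt Gamma (α a + p / n) := by
      refine (differentiableAt_Gamma _ fun m h => ?_).continuousAt
      refine hα a J (Finset.ne_of_mem_erase ha) (k - m) ?_
      rw [harg] at h
      push_cast
      linear_combination h
    exact (hGamma.comp (f := fun w : ℂ => α a + w / n)
      (hderiv a).continuousAt).tendsto.mono_left nhdsWithin_le_nhds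
  have hexp : Tendsto (fun w : ℂ => exp (-(ℓ * w))) (𝓝[≠] p) (𝓝 (exp (ℓ * (n * (α J + k))))) := by
    rw [show ℓ * (n * (α J + k)) = -(ℓ * p) by rw [hp, gammaPole]; ring]
    exact (Continuous.tendsto (by fun_prop) p).mono_left nhdsWithin_le_nhds
  have hlim := ((((tendsto_add_natCast_mul_Gamma k).comp hpole).const_mul (n : ℂ)).mul hexp).mul
    (tendsto_finsetProd _ hregular)
  refine hlim.congr fun w => ?_
  have hlinear : n * (α J + w / n + k) = w - p := by rw [hp, gammaPole]; field_simp; ring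
  rw [gammaKernel, ← Finset.mul_prod_erase Finset.univ _ (Finset.mem_univ J), ← hlinear]
  simp only [Function.comp_apply]
  ring

lemma gammaKernel_sub_natCast (hn : 0 < n) {w : ℂ} (hw : ∀ a, α a + w / n - 1 ≠ 0) :
    gammaKernel α ℓ (w - n) = exp (ℓ * n) / (∏ a, (α a + w / n - 1)) * gammaKernel α ℓ w := by
  have hn0 : (n : ℂ) ≠ 0 := Nat.cast_ne_zero.2 hn.ne'
  have hGamma (a : Fin n) :
      Gamma (α a + w / n) = (α a + w / n - 1) * Gamma (α a + (w - n) / n) := by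
    rw [sub_div, div_self hn0, ← add_sub_assoc, ← Gamma_add_one _ (hw a), sub_add_cancel]
  have hprod : ∏ a, (α a + w / n - 1) ≠ 0 := Finset.prod_ne_zero_iff.2 fun a _ => hw a
  have hexp : exp (-(ℓ * (w - n))) = exp (ℓ * n) * exp (-(ℓ * w)) := by
    rw [← exp_add]; congr 1; ring
  rw [gammaKernel, gammaKernel, Finset.prod_congr rfl fun a _ => hGamma a,
    Finset.prod_mul_distrib, hexp, mul_left_comm (exp (-(ℓ * w))), ← mul_assoc (_ / _),
    div_mul_cancel₀ _ hprod, mul_assoc]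

lemma gammaResidue_succ (hα : ∀ a b, a ≠ b → ∀ k : ℤ, α a - α b ≠ k) (J : Fin n) (k : ℕ) :
    gammaResidue α ℓ J (k + 1) =
      exp (ℓ * n) / (∏ a, (α a - α J - (k + 1))) * gammaResidue α ℓ J k := by
  have hne : ∀ a ∈ Finset.univ.erase J, α a - α J - (k + 1) ≠ 0 := fun a ha h => by
    refine hα a J (Finset.ne_of_mem_erase ha) (k + 1) ?_
    push_cast
    linear_combination h
  have hGamma : ∏ a ∈ Finset.univ.erase J, Gamma (α a - α J - k) =
      (∏ a ∈ Finset.univ.erase J, (α a - α J - (k + 1))) *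
        ∏ a ∈ Finset.univ.erase J, Gamma (α a - α J - (k + 1 : ℕ)) := by
    rw [← Finset.prod_mul_distrib]
    refine Finset.prod_congr rfl fun a ha => ?_
    rw [Nat.cast_succ, ← Gamma_add_one _ (hne a ha)]
    congr 1; ring
  have hprod : ∏ a ∈ Finset.univ.erase J, (α a - α J - (k + 1)) ≠ 0 := Finset.prod_ne_zero_iff.2 hne
  have hk : (k : ℂ) + 1 ≠ 0 := Nat.cast_add_one_ne_zero k
  have hexp : exp (ℓ * (n * (α J + (k + 1 : ℕ)))) =
      exp (ℓ * n) * exp (ℓ * (n * (α J + k))) := by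
    rw [← exp_add]; congr 1; push_cast; ring
  rw [gammaResidue, gammaResidue, hexp, hGamma,
    ← Finset.mul_prod_erase Finset.univ (fun a => α a - α J - (k + 1)) (Finset.mem_univ J),
    Nat.factorial_succ, pow_succ, sub_self, zero_sub]
  push_cast
  field_simp

lemma norm_exp_div_prod_le_half (hn : 0 < n) {x : Fin n → ℂ}
    (hx : ∀ a, 2 * ‖exp (ℓ * n)‖ + 1 ≤ ‖x a‖) : ‖exp (ℓ * n) / ∏ a, x a‖ ≤ 1 / 2 := by
  set T := 2 * ‖exp (ℓ * n)‖ + 1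
  have hT : 1 ≤ T := le_add_of_nonneg_left (by positivity)
  have hprod : T ≤ ‖∏ a, x a‖ :=
    calc T ≤ T ^ n := le_self_pow₀ hT hn.ne'
      _ = ∏ _a : Fin n, T := by simp
      _ ≤ ∏ a, ‖x a‖ := Finset.prod_le_prod (fun _ _ => by positivity) fun a _ => hx a
      _ = ‖∏ a, x a‖ := (norm_prod _ _).symm
  rw [norm_div, div_le_iff₀ (by linarith)]
  linarith

lemma norm_le_sum_norm (x : Fin n → ℂ) (a : Fin n) : ‖x a‖ ≤ ∑ b, ‖x b‖ :=
  Finset.single_le_sum (f := fun b => ‖x b‖) (fun _ _ => norm_nonneg _) (Finset.mem_univ a)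

lemma summable_gammaResidue (hn : 0 < n) (hα : ∀ a b, a ≠ b → ∀ k : ℤ, α a - α b ≠ k)
    (J : Fin n) : Summable (gammaResidue α ℓ J) := by
  refine summable_of_ratio_norm_eventually_le (r := 1 / 2) (by norm_num) ?_
  filter_upwards [tendsto_natCast_atTop_atTop.eventually_ge_atTop
    (∑ a, ‖α a - α J‖ + (2 * ‖exp (ℓ * n)‖ + 1))] with k hk
  rw [gammaResidue_succ hα J k, norm_mul]
  gcongr
  refine norm_exp_div_prod_le_half hn fun a => ?_
  have htriangle := norm_sub_norm_le ((k : ℂ) + 1) (α a - α J)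
  rw [norm_sub_rev ((k : ℂ) + 1), ← Nat.cast_succ, norm_natCast] at htriangle
  push_cast at htriangle
  linarith [norm_le_sum_norm (fun a => α a - α J) a]

/-- The boundaries of the rectangles `[-(X + nN), c] × [-Y, Y]`, for `N : ℕ`, avoid the poles of
`gammaKernel α ℓ`, which all lie to the left of `c` and between the horizontal sides. -/
structure IsPoleFreeFrame (α : Fin n → ℂ) (X c Y : ℝ) : Prop where
  left : ∀ a, ∀ j : ℤ, (α a).re - X / n ≠ j
  right : ∀ a, -(n * (α a).re) < c
  height : ∀ a, n * |(α a).im| < Y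

namespace IsPoleFreeFrame

variable {X c Y : ℝ} (h : IsPoleFreeFrame α X c Y)

include h

lemma height_pos (hn : 0 < n) : 0 < Y :=
  (by positivity : 0 ≤ n * |(α ⟨0, hn⟩).im|).trans_lt (h.height _)

lemma gammaPole_re_ne (hn : 0 < n) (N : ℕ) (J : Fin n) (k : ℕ) :
    (gammaPole α J k).re ≠ -(X + n * N) := fun hre => by
  rw [gammaPole_re] at hre
  have hn' : (n : ℝ) ≠ 0 := Nat.cast_ne_zero.2 hn.ne'
  refine h.left J (N - k) ?_
  push_cast
  field_simp
  linarith

lemma gammaPole_re_lt (J : Fin n) (k : ℕ) : (gammaPole α J k).re < c := by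
  rw [gammaPole_re, mul_add]
  linarith [h.right J, (by positivity : (0 : ℝ) ≤ n * k)]

lemma gammaPole_im_mem (J : Fin n) (k : ℕ) : (gammaPole α J k).im ∈ Ioo (-Y) Y := by
  rw [gammaPole_im, mem_Ioo, ← abs_lt, abs_neg, abs_mul, Nat.abs_cast]
  exact h.height J

lemma gammaPole_mem_interior (hn : 0 < n) {N : ℕ} {J : Fin n} {k : ℕ}
    (hle : -(X + n * N) ≤ (gammaPole α J k).re) :
    gammaPole α J k ∈ Ioo (-(X + n * N)) c ×ℂ Ioo (-Y) Y :=
  ⟨⟨hle.lt_of_ne (h.gammaPole_re_ne hn N J k).symm, h.gammaPole_re_lt J k⟩,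
    h.gammaPole_im_mem J k⟩

lemma continuousOn_gammaKernel (hn : 0 < n) (N : ℕ) :
    ContinuousOn (gammaKernel α ℓ) (rectFrame (-(X + n * N)) c Y) := fun w hw =>
  (differentiableAt_gammaKernel hn fun J k hp => hw.2 (by
    rw [hp]
    exact h.gammaPole_mem_interior hn (hp ▸ hw.1.1.1))).continuousAt.continuousWithinAt

end IsPoleFreeFrame

lemma eventually_neg_add_natCast_mul_le (hn : 0 < n) (X c : ℝ) :
    ∀ᶠ N : ℕ in atTop, -(X + n * N) ≤ c := by
  have hlim : Tendsto (fun N : ℕ => X + n * (N : ℝ)) atTop atTop :=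
    tendsto_atTop_add_const_left _ _
      (tendsto_natCast_atTop_atTop.const_mul_atTop (Nat.cast_pos.2 hn))
  filter_upwards [hlim.eventually_ge_atTop (-c)] with N hN
  linarith

lemma norm_gammaKernel_sub_natCast_le (hn : 0 < n) {w : ℂ}
    (hw : w.re ≤ -(n * (2 * ‖exp (ℓ * n)‖ + ∑ a, ‖α a‖))) :
    ‖gammaKernel α ℓ (w - n)‖ ≤ 1 / 2 * ‖gammaKernel α ℓ w‖ := by
  have hre : w.re / n ≤ -(2 * ‖exp (ℓ * n)‖ + ∑ a, ‖α a‖) := by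
    rw [div_le_iff₀ (Nat.cast_pos.2 hn)]
    linarith
  have hlarge (a : Fin n) : 2 * ‖exp (ℓ * n)‖ + 1 ≤ ‖α a + w / n - 1‖ := by
    have hnorm := (neg_le_abs _).trans (abs_re_le_norm (α a + w / n - 1))
    rw [sub_re, add_re, div_natCast_re, one_re] at hnorm
    linarith [(re_le_norm (α a)).trans (norm_le_sum_norm α a)]
  have hne (a : Fin n) : α a + w / n - 1 ≠ 0 :=
    norm_pos_iff.1 (by linarith [hlarge a, norm_nonneg (exp (ℓ * n))])
  rw [gammaKernel_sub_natCast hn hne, norm_mul]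
  gcongr
  exact norm_exp_div_prod_le_half hn hlarge

lemma IsPoleFreeFrame.tendsto_leftSideIntegral {X c Y : ℝ} (h : IsPoleFreeFrame α X c Y)
    (hn : 0 < n) :
    Tendsto (fun N : ℕ => leftSideIntegral (gammaKernel α ℓ) (-(X + n * N)) Y) atTop (𝓝 0) := by
  have hY : -Y ≤ Y := neg_le_self (h.height_pos hn).le
  set w : ℕ → ℝ → ℂ := fun N y => ((-(X + n * N) : ℝ) : ℂ) + y * I with hw
  obtain ⟨N₀, hN₀⟩ := ((eventually_neg_add_natCast_mul_le hn X
    (-(n * (2 * ‖exp (ℓ * n)‖ + ∑ a, ‖α a‖)))).and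
      (eventually_neg_add_natCast_mul_le hn X c)).exists_forall_of_atTop
  have hhalf : ∀ N ≥ N₀, ∀ y,
      ‖gammaKernel α ℓ (w (N + 1) y)‖ ≤ 1 / 2 * ‖gammaKernel α ℓ (w N y)‖ := fun N hN y => by
    have hsucc : w (N + 1) y = w N y - n := by simp only [hw]; push_cast; ring
    rw [hsucc]
    exact norm_gammaKernel_sub_natCast_le hn (by simpa [hw] using (hN₀ N hN).1)
  obtain ⟨M, hM⟩ := isCompact_Icc.exists_bound_of_continuousOn
    ((h.continuousOn_gammaKernel (ℓ := ℓ) hn N₀).comp (f := w N₀) (s := Icc (-Y) Y) (by fun_prop)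
      fun y hy => vertical_mem_rectFrame (hN₀ N₀ le_rfl).2 (.inl rfl) hy)
  have hbound (N : ℕ) : ∀ y ∈ Icc (-Y) Y, ‖gammaKernel α ℓ (w (N + N₀) y)‖ ≤ (1 / 2) ^ N * M := by
    intro y hy
    induction N with
    | zero => simpa using hM y hy
    | succ N ih =>
      calc ‖gammaKernel α ℓ (w (N + 1 + N₀) y)‖
          ≤ 1 / 2 * ‖gammaKernel α ℓ (w (N + N₀) y)‖ := by
            rw [add_right_comm]
            exact hhalf _ (Nat.le_add_left _ _) y
        _ ≤ 1 / 2 * ((1 / 2) ^ N * M) := by gcongr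
        _ = (1 / 2) ^ (N + 1) * M := by ring
  rw [← tendsto_add_atTop_iff_nat N₀]
  have hlim : Tendsto (fun N : ℕ => (1 / 2 : ℝ) ^ N * M * |Y - -Y|) atTop (𝓝 0) := by
    simpa using ((tendsto_pow_atTop_nhds_zero_of_lt_one (r := (1 / 2 : ℝ)) (by norm_num)
      (by norm_num)).mul_const M).mul_const |Y - -Y|
  refine squeeze_zero_norm (fun N => ?_) hlim
  rw [leftSideIntegral, norm_mul, norm_I, one_mul]
  refine intervalIntegral.norm_integral_le_of_norm_le_const fun y hy => ?_
  rw [uIoc_of_le hY] at hy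
  exact hbound N y (Ioc_subset_Icc_self hy)

lemma IsPoleFreeFrame.rectIntegral_gammaKernel {X c Y : ℝ} (h : IsPoleFreeFrame α X c Y)
    (hn : 0 < n) (hα : ∀ a b, a ≠ b → ∀ k : ℤ, α a - α b ≠ k) {N : ℕ}
    (hN : -(X + n * N) ≤ c) :
    rectIntegral (gammaKernel α ℓ) (-(X + n * N)) c Y = 2 * Real.pi * I *
      ∑ J, ∑ k ∈ Finset.range ⌈X / n + N - (α J).re⌉₊, gammaResidue α ℓ J k := by
  have hn' : (0 : ℝ) < n := Nat.cast_pos.2 hn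
  have hrange (J : Fin n) (k : ℕ) : k ∈ Finset.range ⌈X / n + N - (α J).re⌉₊ ↔
      -(X + n * N) < (gammaPole α J k).re := by
    have hscale : X + n * N = n * (X / n + N) := by field_simp
    rw [Finset.mem_range, Nat.lt_ceil, gammaPole_re, neg_lt_neg_iff, hscale,
      mul_lt_mul_iff_right₀ hn', lt_sub_iff_add_lt, add_comm]
  rw [Finset.sum_sigma']
  refine rectIntegral_eq_sum_residues _ hN (h.height_pos hn).le (gammaPole_injective hn hα) ?_ ?_
    fun i _ => tendsto_sub_gammaPole_mul_gammaKernel hn hα i.1 i.2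
  · exact fun i hi => h.gammaPole_mem_interior hn
      ((hrange i.1 i.2).1 (Finset.mem_sigma.1 hi).2).le
  · intro w hw
    refine (differentiableAt_gammaKernel hn fun J k hp => hw.2 ?_).differentiableWithinAt
    refine ⟨⟨J, k⟩, Finset.mem_sigma.2 ⟨Finset.mem_univ J, (hrange J k).2 ?_⟩, hp.symm⟩
    exact (hp ▸ hw.1.1.1 : _ ≤ (gammaPole α J k).re).lt_of_ne (h.gammaPole_re_ne hn N J k).symm

lemma IsPoleFreeFrame.tendsto_threeSideIntegral {X c Y : ℝ} (h : IsPoleFreeFrame α X c Y)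
    (hn : 0 < n) (hα : ∀ a b, a ≠ b → ∀ k : ℤ, α a - α b ≠ k) :
    Tendsto (fun N : ℕ => threeSideIntegral (gammaKernel α ℓ) (-(X + n * N)) c Y) atTop
      (𝓝 (2 * Real.pi * I * ∑ J, ∑' k, gammaResidue α ℓ J k)) := by
  have hrange (J : Fin n) : Tendsto (fun N : ℕ => ⌈X / n + N - (α J).re⌉₊) atTop atTop := by
    refine tendsto_nat_ceil_atTop.comp ((tendsto_atTop_add_const_left atTop (X / n - (α J).re)
      tendsto_natCast_atTop_atTop).congr fun N => ?_)
    ring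
  have hsum := (tendsto_finsetSum Finset.univ fun J _ =>
    (summable_gammaResidue (ℓ := ℓ) hn hα J).hasSum.tendsto_sum_nat.comp (hrange J)).const_mul
      (2 * Real.pi * I)
  have hlim := hsum.add (h.tendsto_leftSideIntegral (ℓ := ℓ) hn)
  rw [add_zero] at hlim
  refine hlim.congr' ?_
  filter_upwards [eventually_neg_add_natCast_mul_le hn X c] with N hN
  simp only [Function.comp_apply, ← h.rectIntegral_gammaKernel hn hα hN, rectIntegral,
    sub_add_cancel]

end GammaKernel

lemma gammaKernel_one (b ℓ w : ℂ) :
    gammaKernel (fun _ : Fin 1 => b) ℓ w = exp (-(ℓ * w)) * Gamma (b + w) := by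
  simp [gammaKernel]

lemma tsum_gammaResidue_one (b ℓ : ℂ) :
    ∑ J, ∑' k, gammaResidue (fun _ : Fin 1 => b) ℓ J k = exp (ℓ * b) * exp (-exp ℓ) := by
  have hterm (k : ℕ) : gammaResidue (fun _ : Fin 1 => b) ℓ 0 k =
      exp (ℓ * b) * ((-exp ℓ) ^ k / k.factorial) := by
    have hempty : (Finset.univ : Finset (Fin 1)).erase 0 = ∅ := rfl
    have hexp : ℓ * ((1 : ℕ) * (b + k)) = ℓ * b + k * ℓ := by push_cast; ring
    rw [gammaResidue, hempty, Finset.prod_empty, neg_pow (exp ℓ), ← exp_nat_mul, hexp, exp_add]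
    push_cast
    ring
  rw [Fin.sum_univ_one, tsum_congr hterm, tsum_mul_left, exp_eq_exp_ℂ,
    NormedSpace.exp_eq_tsum_div]

section SaddlePath

variable {S w : ℂ}

lemma gammaExponent_log (S w : ℂ) : gammaExponent (log S) w =
    w.re * (Real.log ‖w‖ - Real.log ‖S‖ - 1) - w.im * (arg w - arg S) := by
  simp only [gammaExponent, sub_re, mul_re, log_re, log_im]
  ring

lemma gammaExponent_log_self (S : ℂ) : gammaExponent (log S) S = -S.re := by
  rw [gammaExponent_log]
  ring

lemma gammaExponent_log_conj (hS : S ∈ slitPlane) (hw : w ∈ slitPlane) :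
    gammaExponent (log (starRingEnd ℂ S)) (starRingEnd ℂ w) = gammaExponent (log S) w := by
  rw [gammaExponent_log, gammaExponent_log, norm_conj, norm_conj, arg_conj, arg_conj,
    if_neg (mem_slitPlane_iff_arg.1 hw).1, if_neg (mem_slitPlane_iff_arg.1 hS).1, conj_re, conj_im]
  ring

lemma hasDerivAt_gammaExponent_comp {γ : ℝ → ℂ} {v ℓ : ℂ} {t : ℝ} (hγ : HasDerivAt γ v t)
    (ht : γ t ∈ slitPlane) :
    HasDerivAt (fun t => gammaExponent ℓ (γ t)) (v * (log (γ t) - ℓ)).re t := by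
  have hderiv := ((hγ.mul (hγ.clog_real ht)).sub hγ).sub (hγ.const_mul ℓ)
  have hsimp : v * log (γ t) + γ t * (v / γ t) - v - ℓ * v = v * (log (γ t) - ℓ) := by
    field_simp [slitPlane_ne_zero ht]
    ring
  rw [hsimp] at hderiv
  simpa using! (reCLM.hasFDerivAt (x := γ t * log (γ t) - γ t - ℓ * γ t)).comp_hasDerivAt t hderiv

lemma gammaExponent_add_le_of_segment {ℓ w v : ℂ} {B : ℝ}
    (h : ∀ t ∈ Icc (0 : ℝ) 1, w + t * v ∈ slitPlane ∧ (v * (log (w + t * v) - ℓ)).re ≤ B) :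
    gammaExponent ℓ (w + v) ≤ gammaExponent ℓ w + B := by
  have hderiv : ∀ t ∈ Icc (0 : ℝ) 1, HasDerivAt (fun t : ℝ => gammaExponent ℓ (w + t * v))
      (v * (log (w + t * v) - ℓ)).re t := fun t ht =>
    hasDerivAt_gammaExponent_comp
      (by simpa using ((hasDerivAt_id t).ofReal_comp.mul_const v).const_add w) (h t ht).1
  have hmean := (convex_Icc (0 : ℝ) 1).image_sub_le_mul_sub_of_deriv_le
    (fun t ht => (hderiv t ht).continuousAt.continuousWithinAt)
    (fun t ht => (hderiv t (interior_subset ht)).differentiableAt.differentiableWithinAt)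
    (C := B) (fun t ht => (hderiv t (interior_subset ht)).deriv ▸ (h t (interior_subset ht)).2)
    0 (by simp) 1 (by simp) zero_le_one
  simp only [ofReal_one, one_mul, ofReal_zero, zero_mul, add_zero, sub_zero, mul_one] at hmean
  linarith

lemma gammaExponent_le_of_vertical {ℓ : ℂ} {x y₀ y B : ℝ} (hx : 0 < x)
    (h : ∀ y' ∈ uIcc y₀ y, (y - y₀) * (ℓ.im - arg (x + y' * I)) ≤ B) :
    gammaExponent ℓ (x + y * I) ≤ gammaExponent ℓ (x + y₀ * I) + B := by
  have hsum : (x + y * I : ℂ) = x + y₀ * I + (y - y₀ : ℝ) * I := by push_cast; ring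
  rw [hsum]
  refine gammaExponent_add_le_of_segment fun t ht => ?_
  have hpoint : (x + y₀ * I + t * ((y - y₀ : ℝ) * I) : ℂ) = x + (y₀ + t * (y - y₀) : ℝ) * I := by
    push_cast; ring
  rw [hpoint]
  refine ⟨mem_slitPlane_iff.2 (.inl (by simpa using hx)), ?_⟩
  have hy' : y₀ + t * (y - y₀) ∈ uIcc y₀ y := by
    simpa [AffineMap.lineMap_apply, add_comm, ← segment_eq_uIcc, segment_eq_image_lineMap] using
      mem_image_of_mem (AffineMap.lineMap y₀ y) ht
  refine le_of_eq_of_le ?_ (h _ hy')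
  rw [mul_assoc, re_ofReal_mul, I_mul_re, sub_im, log_im, neg_sub]

lemma gammaExponent_le_of_horizontal {ℓ : ℂ} {x₀ x y B : ℝ} (hy : y ≠ 0)
    (h : ∀ x' ∈ uIcc x₀ x, (x - x₀) * (Real.log ‖(x' + y * I : ℂ)‖ - ℓ.re) ≤ B) :
    gammaExponent ℓ (x + y * I) ≤ gammaExponent ℓ (x₀ + y * I) + B := by
  have hsum : (x + y * I : ℂ) = x₀ + y * I + (x - x₀ : ℝ) := by push_cast; ring
  rw [hsum]
  refine gammaExponent_add_le_of_segment fun t ht => ?_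
  have hpoint : (x₀ + y * I + t * (x - x₀ : ℝ) : ℂ) = (x₀ + t * (x - x₀) : ℝ) + y * I := by
    push_cast; ring
  rw [hpoint]
  refine ⟨mem_slitPlane_iff.2 (.inr (by simpa using hy)), ?_⟩
  have hx' : x₀ + t * (x - x₀) ∈ uIcc x₀ x := by
    simpa [AffineMap.lineMap_apply, add_comm, ← segment_eq_uIcc, segment_eq_image_lineMap] using
      mem_image_of_mem (AffineMap.lineMap x₀ x) ht
  rw [re_ofReal_mul, sub_re, log_re]
  exact h _ hx'

lemma arg_le_arg_of_im_le {x y y' : ℝ} (hx : 0 < x) (h : y ≤ y') :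
    arg (x + y * I) ≤ arg (x + y' * I) := by
  have harg (t : ℝ) : arg (x + t * I) = Real.arctan (t / x) := by
    have hbound := abs_lt.1 (abs_arg_lt_pi_div_two_iff.2 (.inl (by simpa using hx :
      0 < (x + t * I : ℂ).re)))
    rw [← Real.arctan_tan hbound.1 hbound.2, tan_arg]
    simp
  rw [harg, harg]
  exact Real.arctan_strictMono.monotone (by gcongr)

lemma gammaExponent_log_vertical_le (hS : 0 < S.re) (y : ℝ) :
    gammaExponent (log S) (S.re + y * I) ≤ -S.re := by
  refine (gammaExponent_le_of_vertical (y₀ := S.im) (B := 0) hS fun y' hy' => ?_).trans_eq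
    (by rw [re_add_im, gammaExponent_log_self, add_zero])
  have harg : arg S = arg (S.re + S.im * I) := by rw [re_add_im]
  rw [log_im, harg]
  rcases le_total S.im y with h | h
  · rw [uIcc_of_le h] at hy'
    exact mul_nonpos_of_nonneg_of_nonpos (sub_nonneg.2 h)
      (sub_nonpos.2 (arg_le_arg_of_im_le hS hy'.1))
  · rw [uIcc_of_ge h] at hy'
    exact mul_nonpos_of_nonpos_of_nonneg (sub_nonpos.2 h)
      (sub_nonneg.2 (arg_le_arg_of_im_le hS hy'.2))

lemma gammaExponent_log_horizontal_le_of_re_pos (hS : 0 < S.re) {x y : ℝ} (hx : x ≤ S.re)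
    (hy : |y| = ‖S‖) : gammaExponent (log S) (x + y * I) ≤ -S.re := by
  have hSpos : 0 < ‖S‖ := hS.trans_le (re_le_norm S)
  refine (gammaExponent_le_of_horizontal (x₀ := S.re) (B := 0) (abs_pos.1 (hy ▸ hSpos))
    fun x' _ => ?_).trans (by simpa using gammaExponent_log_vertical_le hS y)
  rw [log_re]
  refine mul_nonpos_of_nonpos_of_nonneg (sub_nonpos.2 hx)
    (sub_nonneg.2 (Real.log_le_log hSpos ?_))
  simpa [hy] using abs_im_le_norm (x' + y * I)

lemma mul_cos_le_sin {δ : ℝ} (hδ : 0 ≤ δ) (hδ' : δ ≤ Real.pi / 2) :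
    δ * Real.cos δ ≤ Real.sin δ := by
  rcases hδ'.eq_or_lt with rfl | hlt
  · rw [Real.cos_pi_div_two, mul_zero, Real.sin_pi_div_two]
    exact zero_le_one
  · have hcos : 0 < Real.cos δ := Real.cos_pos_of_mem_Ioo ⟨by linarith, hlt⟩
    rw [← le_div_iff₀ hcos, ← Real.tan_eq_sin_div_cos]
    exact Real.le_tan hδ hlt

lemma neg_im_mul_arg_le_of_re_nonneg (hre : 0 ≤ w.re) (him : 0 ≤ w.im) :
    -(w.im * arg w) ≤ w.re - w.im * (Real.pi / 2) := by
  have hsin := mul_cos_le_sin (δ := Real.pi / 2 - arg w)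
    (by linarith [(abs_le.1 (abs_arg_le_pi_div_two_iff.2 hre)).2])
    (by linarith [arg_nonneg_iff.2 him])
  rw [Real.cos_pi_div_two_sub, Real.sin_pi_div_two_sub] at hsin
  have hmul := mul_le_mul_of_nonneg_left hsin (norm_nonneg w)
  rw [mul_left_comm, norm_mul_sin_arg, norm_mul_cos_arg] at hmul
  linarith

lemma re_add_im_mul_arg_le (harg : Real.pi / 2 ≤ arg w) :
    w.re + w.im * arg w ≤ w.im * (Real.pi / 2) := by
  have hsin := mul_cos_le_sin (δ := arg w - Real.pi / 2) (by linarith)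
    (by linarith [arg_le_pi w])
  rw [Real.cos_sub_pi_div_two, Real.sin_sub_pi_div_two] at hsin
  have hmul := mul_le_mul_of_nonneg_left hsin (norm_nonneg w)
  rw [mul_left_comm, norm_mul_sin_arg, mul_neg, norm_mul_cos_arg] at hmul
  linarith

lemma gammaExponent_log_vertical_le_of_re_nonpos (hre : S.re ≤ 0) (him : 0 < S.im)
    (hw : 0 < w.re) (hwS : |w.im| ≤ S.im) :
    gammaExponent (log S) w ≤ w.re * (Real.log ‖w‖ - Real.log ‖S‖) - S.re := by
  have hargS : Real.pi / 2 ≤ arg S := by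
    rw [← not_lt, arg_lt_pi_div_two_iff, not_or, not_or]
    exact ⟨hre.not_gt, him.not_gt, fun h => by simp [h] at him⟩
  suffices -(w.im * arg w) + w.im * arg S ≤ w.re - S.re by
    rw [gammaExponent_log]
    linarith
  rcases le_or_gt 0 w.im with h | h
  · rw [abs_of_nonneg h] at hwS
    have hmul := mul_le_mul_of_nonneg_right hwS (sub_nonneg.2 hargS)
    linarith [neg_im_mul_arg_le_of_re_nonneg hw.le h, re_add_im_mul_arg_le hargS]
  · have hneg := mul_nonneg_of_nonpos_of_nonpos h.le (arg_neg_iff.2 h).le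
    have hpos := mul_nonpos_of_nonpos_of_nonneg h.le (arg_nonneg_iff.2 him.le)
    linarith

lemma log_norm_sub_log_norm_le (hS : S ≠ 0) (hw : w ≠ 0) :
    Real.log ‖w‖ - Real.log ‖S‖ ≤ (‖w‖ ^ 2 - ‖S‖ ^ 2) / (2 * ‖S‖ ^ 2) := by
  have hS' : ‖S‖ ≠ 0 := norm_ne_zero_iff.2 hS
  have hlog := Real.log_le_sub_one_of_pos (x := ‖w‖ ^ 2 / ‖S‖ ^ 2) (by positivity)
  rw [Real.log_div (by positivity) (by positivity), Real.log_pow, Real.log_pow] at hlog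
  have hsq : ‖w‖ ^ 2 / ‖S‖ ^ 2 - 1 = 2 * ((‖w‖ ^ 2 - ‖S‖ ^ 2) / (2 * ‖S‖ ^ 2)) := by
    field_simp
  push_cast at hlog
  linarith

lemma sq_norm_ofReal_add_ofReal_mul_I (x y : ℝ) : ‖(x + y * I : ℂ)‖ ^ 2 = x ^ 2 + y ^ 2 := by
  rw [Complex.sq_norm, normSq_add_mul_I]

lemma gammaExponent_log_horizontal_le_of_re_nonpos (hS : 1 ≤ ‖S‖) (hre : S.re ≤ 0)
    (him : 0 < S.im) {c : ℝ} (hc : 0 ≤ c) (hcS : c ≤ ‖S‖) {x : ℝ} (hx : x ≤ c) :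
    gammaExponent (log S) (x + S.im * I) ≤ c ^ 2 - S.re := by
  refine (gammaExponent_le_of_horizontal (x₀ := S.re) (B := c ^ 2) him.ne'
    fun x' hx' => ?_).trans_eq (by rw [re_add_im, gammaExponent_log_self, neg_add_eq_sub])
  have hSne : S ≠ 0 := norm_pos_iff.1 (by linarith)
  have hwne : (x' + S.im * I : ℂ) ≠ 0 := fun h => him.ne' (by simpa using congrArg im h)
  have hsq : ‖(x' + S.im * I : ℂ)‖ ^ 2 - ‖S‖ ^ 2 = x' ^ 2 - S.re ^ 2 := by
    have hSsq := sq_norm_ofReal_add_ofReal_mul_I S.re S.im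
    rw [re_add_im] at hSsq
    rw [sq_norm_ofReal_add_ofReal_mul_I, hSsq]
    ring
  rw [log_re]
  rcases le_total x S.re with h | h
  · rw [uIcc_of_ge h] at hx'
    have hnorm : ‖S‖ ≤ ‖(x' + S.im * I : ℂ)‖ := by
      refine (sq_le_sq₀ (norm_nonneg _) (norm_nonneg _)).1 ?_
      nlinarith [hx'.2]
    exact (mul_nonpos_of_nonpos_of_nonneg (sub_nonpos.2 h)
      (sub_nonneg.2 (Real.log_le_log (norm_pos_iff.2 hSne) hnorm))).trans (sq_nonneg c)
  · rw [uIcc_of_le h] at hx'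
    have hx'sq : x' ^ 2 - S.re ^ 2 ≤ c ^ 2 := by
      rcases le_total 0 x' with h0 | h0 <;> nlinarith [hx'.1, hx'.2]
    have hxS : x - S.re ≤ 2 * ‖S‖ := by linarith [(neg_le_abs _).trans (abs_re_le_norm S)]
    calc (x - S.re) * (Real.log ‖(x' + S.im * I : ℂ)‖ - Real.log ‖S‖)
        ≤ (x - S.re) * (c ^ 2 / (2 * ‖S‖ ^ 2)) := by
          refine mul_le_mul_of_nonneg_left ?_ (sub_nonneg.2 h)
          refine (log_norm_sub_log_norm_le hSne hwne).trans ?_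
          rw [hsq]
          gcongr
      _ ≤ 2 * ‖S‖ * (c ^ 2 / (2 * ‖S‖ ^ 2)) := by gcongr
      _ = c ^ 2 / ‖S‖ := by field_simp
      _ ≤ c ^ 2 := div_le_self (sq_nonneg c) hS

lemma gammaExponent_log_conj_le (hS : 0 ≤ S.im) (hw : 0 < w.im) :
    gammaExponent (log S) (starRingEnd ℂ w) ≤ gammaExponent (log S) w := by
  have harg : arg w ≠ Real.pi :=
    (mem_slitPlane_iff_arg.1 (mem_slitPlane_iff.2 (.inr hw.ne'))).1
  rw [gammaExponent_log, gammaExponent_log, norm_conj, arg_conj, if_neg harg, conj_re, conj_im]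
  linarith [mul_nonneg hw.le (arg_nonneg_iff.2 hS)]

lemma gammaExponent_log_le_re_div (hS : 1 ≤ ‖S‖) (him : |w.im| ≤ ‖S‖)
    (hre : w.re ≤ -(Real.exp 10 * ‖S‖)) : gammaExponent (log S) w ≤ w.re / ‖S‖ - S.re := by
  have hSpos : 0 < ‖S‖ := by linarith
  have hSw : ‖S‖ ≤ -w.re := by nlinarith [Real.one_le_exp (x := 10) (by norm_num)]
  have hlog : 10 ≤ Real.log ‖w‖ - Real.log ‖S‖ := by
    have hle := Real.log_le_log (by positivity)
      ((le_neg_of_le_neg hre).trans ((neg_le_abs _).trans (abs_re_le_norm w)))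
    rw [Real.log_mul (by positivity) hSpos.ne', Real.log_exp] at hle
    linarith
  have hradial : w.re * (Real.log ‖w‖ - Real.log ‖S‖ - 1) ≤ 9 * w.re := by nlinarith
  have hangular : -(w.im * (arg w - arg S)) ≤ ‖S‖ * 7 := by
    refine (neg_le_abs _).trans ((abs_mul _ _).trans_le ?_)
    gcongr
    linarith [abs_sub (arg w) (arg S), abs_arg_le_pi w, abs_arg_le_pi S, Real.pi_lt_d2]
  have hdiv : -w.re / ‖S‖ ≤ -w.re := div_le_self (by linarith) hS
  rw [gammaExponent_log]
  linarith [re_le_norm S, neg_div ‖S‖ w.re]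

lemma exp_gammaExponent_log_add_re_le {B : ℝ} (hS : 1 ≤ ‖S‖) (him : |w.im| ≤ ‖S‖)
    (hre : w.re ≤ ‖S‖) (hB : gammaExponent (log S) w ≤ B - S.re) :
    Real.exp (gammaExponent (log S) w + S.re) ≤
      (Real.exp B * (1 + Real.exp 20) + 2) / (1 + (w.re / ‖S‖) ^ 2) := by
  have hSpos : 0 < ‖S‖ := by linarith
  rw [le_div_iff₀ (by positivity)]
  rcases le_total w.re (-(Real.exp 10 * ‖S‖)) with h | h
  · set v := -(w.re / ‖S‖) with hv
    have hv0 : 0 ≤ v := neg_nonneg.2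
      (div_nonpos_of_nonpos_of_nonneg (h.trans (neg_nonpos.2 (by positivity))) hSpos.le)
    have hexp : Real.exp (gammaExponent (log S) w + S.re) ≤ Real.exp (-v) :=
      Real.exp_le_exp.2 (by linarith [gammaExponent_log_le_re_div hS him h])
    calc Real.exp (gammaExponent (log S) w + S.re) * (1 + (w.re / ‖S‖) ^ 2)
        ≤ Real.exp (-v) * (1 + v ^ 2) := by
          rw [hv, neg_sq]
          gcongr
      _ ≤ 2 := by
          rw [Real.exp_neg, inv_mul_le_iff₀ (Real.exp_pos _)]
          nlinarith [Real.quadratic_le_exp_of_nonneg hv0]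
      _ ≤ Real.exp B * (1 + Real.exp 20) + 2 := le_add_of_nonneg_left (by positivity)
  · have hratio : |w.re / ‖S‖| ≤ Real.exp 10 := by
      rw [abs_div, abs_of_pos hSpos, div_le_iff₀ hSpos, abs_le]
      exact ⟨h, by nlinarith [Real.one_le_exp (x := 10) (by norm_num)]⟩
    have hexp20 : Real.exp 20 = Real.exp 10 ^ 2 := by
      rw [← Real.exp_nat_mul]
      norm_num
    calc Real.exp (gammaExponent (log S) w + S.re) * (1 + (w.re / ‖S‖) ^ 2)
        ≤ Real.exp B * (1 + Real.exp 20) := by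
          rw [hexp20, ← sq_abs (w.re / ‖S‖)]
          gcongr
          linarith
      _ ≤ Real.exp B * (1 + Real.exp 20) + 2 := le_add_of_nonneg_right zero_le_two

/-- The rectangle with right side at abscissa `c` and half-height `Y`, of the size of the saddle
point `w = S` of `e^{-w log S} Γ(w)`, on whose boundary that function is at most its size
`e^{-Re S}` at the saddle up to a constant `κ`: with quadratic growth on the right side and with
integrable decay on the horizontal sides, which extend to `-∞`. The right side stays beyond a
prescribed abscissa `K`. -/
structure IsSaddleRectangle (κ K : ℝ) (S : ℂ) (c Y : ℝ) : Prop where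
  le_right : K ≤ c
  right_le : c ≤ ‖S‖
  le_height : ‖S‖ ≤ κ * Y
  height_le : Y ≤ ‖S‖
  vertical : ∀ y : ℝ, |y| ≤ Y →
    Real.exp (gammaExponent (log S) (c + y * I) + S.re) ≤ κ * (‖(c + y * I : ℂ)‖ / ‖S‖) ^ 2
  horizontal : ∀ x ≤ c, ∀ y : ℝ, |y| = Y →
    Real.exp (gammaExponent (log S) (x + y * I) + S.re) ≤ κ / (1 + (x / ‖S‖) ^ 2)

lemma IsSaddleRectangle.conj {κ K c Y : ℝ} (hS : S ∈ slitPlane) (hY : 0 < Y) (hc : 0 < c)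
    (h : IsSaddleRectangle κ K S c Y) : IsSaddleRectangle κ K (starRingEnd ℂ S) c Y := by
  have hconj (x y : ℝ) : (x + y * I : ℂ) = starRingEnd ℂ (x + (-y : ℝ) * I) := by simp
  refine ⟨h.le_right, by simpa using h.right_le, by simpa using h.le_height,
    by simpa using h.height_le, fun y hy => ?_, fun x hx y hy => ?_⟩
  · have hw : (c + (-y : ℝ) * I : ℂ) ∈ slitPlane := mem_slitPlane_iff.2 (.inl (by simpa using hc))
    rw [hconj, gammaExponent_log_conj hS hw, conj_re, norm_conj, norm_conj]
    exact h.vertical (-y) (by rwa [abs_neg])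
  · have hw : (x + (-y : ℝ) * I : ℂ) ∈ slitPlane :=
      mem_slitPlane_iff.2 (.inr (by simpa using abs_pos.1 (hy ▸ hY)))
    rw [hconj, gammaExponent_log_conj hS hw, conj_re, norm_conj]
    exact h.horizontal x hx (-y) (by rwa [abs_neg])

lemma isSaddleRectangle_of_re_pos {K : ℝ} (hS : 1 ≤ ‖S‖) (hre : 0 < S.re) (hK : K ≤ S.re) :
    IsSaddleRectangle (Real.exp 0 * (1 + Real.exp 20) + 2 + (‖S‖ / S.re) ^ 2) K S S.re ‖S‖ := by
  have hSpos : 0 < ‖S‖ := by linarith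
  have hexp : 0 ≤ Real.exp 0 * (1 + Real.exp 20) := by positivity
  have hratio : 0 ≤ (‖S‖ / S.re) ^ 2 := sq_nonneg _
  refine ⟨hK, re_le_norm S, le_mul_of_one_le_left hSpos.le (by linarith), le_rfl,
    fun y _ => ?_, fun x hx y hy => ?_⟩
  · have hnorm : S.re ≤ ‖(S.re + y * I : ℂ)‖ := by
      simpa using re_le_norm (S.re + y * I : ℂ)
    calc Real.exp (gammaExponent (log S) (S.re + y * I) + S.re)
        ≤ 1 := Real.exp_le_one_iff.2 (by linarith [gammaExponent_log_vertical_le hre y])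
      _ = (‖S‖ / S.re) ^ 2 * (S.re / ‖S‖) ^ 2 := by field_simp
      _ ≤ _ := by
        gcongr
        linarith
  · have hbound := exp_gammaExponent_log_add_re_le (w := x + y * I) (B := 0) hS (by simp [hy])
      (by simpa using hx.trans (re_le_norm S))
      (by simpa using gammaExponent_log_horizontal_le_of_re_pos hre hx hy)
    simp only [add_re, ofReal_re, re_ofReal_mul, I_re, mul_zero, add_zero] at hbound
    exact hbound.trans (div_le_div_of_nonneg_right (le_add_of_nonneg_right hratio) (by positivity))

lemma exp_gammaExponent_vertical_le_of_re_nonpos (hre : S.re ≤ 0) (him : 0 < S.im)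
    (hw : 2 ≤ w.re) (hwS : w.re ≤ ‖S‖) (hwim : |w.im| ≤ S.im) :
    Real.exp (gammaExponent (log S) w + S.re) ≤ 2 ^ w.re * (‖w‖ / ‖S‖) ^ 2 := by
  have hwpos : 0 < ‖w‖ := by linarith [re_le_norm w]
  have hSpos : 0 < ‖S‖ := by linarith
  have hle : ‖w‖ / ‖S‖ / 2 ≤ 1 := by
    rw [div_div, div_le_one (by positivity)]
    linarith [norm_le_abs_re_add_abs_im w, abs_of_pos (show 0 < w.re by linarith),
      (le_abs_self _).trans (abs_im_le_norm S)]
  calc Real.exp (gammaExponent (log S) w + S.re)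
      ≤ Real.exp (w.re * (Real.log ‖w‖ - Real.log ‖S‖)) := Real.exp_le_exp.2 (by
        linarith [gammaExponent_log_vertical_le_of_re_nonpos hre him (by linarith) hwim])
    _ = (‖w‖ / ‖S‖) ^ w.re := by
      rw [Real.rpow_def_of_pos (by positivity), Real.log_div hwpos.ne' hSpos.ne', mul_comm]
    _ = 2 ^ w.re * (‖w‖ / ‖S‖ / 2) ^ w.re := by
      rw [← Real.mul_rpow (by norm_num) (by positivity), mul_div_cancel₀ _ two_ne_zero]
    _ ≤ 2 ^ w.re * (‖w‖ / ‖S‖ / 2) ^ (2 : ℝ) := by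
      gcongr 2 ^ w.re * ?_
      exact Real.rpow_le_rpow_of_exponent_ge (by positivity) hle hw
    _ ≤ 2 ^ w.re * (‖w‖ / ‖S‖) ^ 2 := by
      rw [Real.rpow_two]
      gcongr 2 ^ w.re * ?_ ^ 2
      exact half_le_self (div_nonneg hwpos.le hSpos.le)

lemma isSaddleRectangle_of_re_nonpos {K c : ℝ} (hre : S.re ≤ 0) (him : 0 < S.im) (hK : K ≤ c)
    (hc : 2 ≤ c) (hcS : c ≤ ‖S‖) :
    IsSaddleRectangle (Real.exp (c ^ 2) * (1 + Real.exp 20) + 2 + ‖S‖ / S.im + 2 ^ c)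
      K S c S.im := by
  have himS : S.im ≤ ‖S‖ := (le_abs_self _).trans (abs_im_le_norm S)
  have hexp : 0 ≤ Real.exp (c ^ 2) * (1 + Real.exp 20) := by positivity
  have hratio : 0 ≤ ‖S‖ / S.im := by positivity
  have hpow : (0 : ℝ) ≤ 2 ^ c := by positivity
  have hexponent : ∀ x ≤ c, ∀ y : ℝ, |y| = S.im →
      gammaExponent (log S) (x + y * I) ≤ c ^ 2 - S.re := fun x hx y hy => by
    have hupper := gammaExponent_log_horizontal_le_of_re_nonpos (by linarith) hre him
      (by linarith) hcS hx
    rcases eq_or_eq_neg_of_abs_eq hy with rfl | rfl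
    · exact hupper
    · refine le_trans ?_ hupper
      simpa using gammaExponent_log_conj_le (w := x + S.im * I) him.le (by simpa using him)
  refine ⟨hK, hcS, ?_, himS, fun y hy => ?_, fun x hx y hy => ?_⟩
  · rw [← div_le_iff₀ him]
    linarith
  · have hbound := exp_gammaExponent_vertical_le_of_re_nonpos (w := c + y * I) hre him
      (by simpa using hc) (by simpa using hcS) (by simpa using hy)
    simp only [add_re, ofReal_re, re_ofReal_mul, I_re, mul_zero, add_zero] at hbound
    refine hbound.trans ?_
    gcongr
    linarith
  · have hbound := exp_gammaExponent_log_add_re_le (w := x + y * I) (by linarith)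
      (by simpa [hy] using himS) (by simpa using hx.trans hcS) (hexponent x hx y hy)
    simp only [add_re, ofReal_re, re_ofReal_mul, I_re, mul_zero, add_zero] at hbound
    refine hbound.trans (div_le_div_of_nonneg_right ?_ (by positivity))
    linarith

lemma exists_isSaddleRectangle_of_im_nonneg {u : ℂ} (hu : ‖u‖ = 1) (hs : u ∈ slitPlane)
    (him : 0 ≤ u.im) (K : ℝ) :
    ∃ κ > 0, ∀ᶠ ρ : ℝ in atTop, ∃ c Y, IsSaddleRectangle κ K (ρ * u) c Y := by
  have hnorm {ρ : ℝ} (hρ : 1 ≤ ρ) : ‖(ρ * u : ℂ)‖ = ρ := by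
    rw [norm_mul, hu, mul_one, norm_real, Real.norm_of_nonneg (by linarith)]
  rcases lt_or_ge 0 u.re with hre | hre
  · refine ⟨Real.exp 0 * (1 + Real.exp 20) + 2 + (1 / u.re) ^ 2, by positivity, ?_⟩
    filter_upwards [eventually_ge_atTop 1, eventually_ge_atTop (K / u.re)] with ρ hρ hK
    have hρ0 : 0 < ρ := by linarith
    have h := isSaddleRectangle_of_re_pos (S := ρ * u) (K := K) (by rwa [hnorm hρ])
      (by rw [re_ofReal_mul]; positivity) (by rwa [re_ofReal_mul, ← div_le_iff₀ hre])
    rw [hnorm hρ, re_ofReal_mul, ← div_div, div_self hρ0.ne'] at h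
    exact ⟨_, _, h⟩
  · have him' : 0 < u.im := him.lt_of_ne' ((mem_slitPlane_iff.1 hs).resolve_left hre.not_gt)
    set c := max K 2
    refine ⟨Real.exp (c ^ 2) * (1 + Real.exp 20) + 2 + 1 / u.im + 2 ^ c, by positivity, ?_⟩
    filter_upwards [eventually_ge_atTop 1, eventually_ge_atTop c] with ρ hρ hc
    have hρ0 : 0 < ρ := by linarith
    have h := isSaddleRectangle_of_re_nonpos (S := ρ * u) (K := K) (c := c)
      (by rw [re_ofReal_mul]; exact mul_nonpos_of_nonneg_of_nonpos hρ0.le hre)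
      (by rw [im_ofReal_mul]; positivity) (le_max_left _ _) (le_max_right _ _) (by rwa [hnorm hρ])
    rw [hnorm hρ, im_ofReal_mul, ← div_div, div_self hρ0.ne'] at h
    exact ⟨_, _, h⟩

theorem exists_isSaddleRectangle {u : ℂ} (hu : ‖u‖ = 1) (hs : u ∈ slitPlane) {K : ℝ} (hK : 0 < K) :
    ∃ κ > 0, ∀ᶠ ρ : ℝ in atTop, ∃ c Y, IsSaddleRectangle κ K (ρ * u) c Y := by
  rcases le_or_gt 0 u.im with him | him
  · exact exists_isSaddleRectangle_of_im_nonneg hu hs him K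
  obtain ⟨κ, hκ, h⟩ := exists_isSaddleRectangle_of_im_nonneg (u := starRingEnd ℂ u)
    (by rwa [norm_conj]) (mem_slitPlane_iff.2 (.inr (by simpa using him.ne)))
    (by simpa using him.le) K
  refine ⟨κ, hκ, ?_⟩
  filter_upwards [h, eventually_gt_atTop 0] with ρ ⟨c, Y, hcY⟩ hρ
  have hslit : (ρ * starRingEnd ℂ u : ℂ) ∈ slitPlane :=
    mem_slitPlane_iff.2 (.inr (by simpa [hρ.ne'] using him.ne))
  have hY : 0 < Y := pos_of_mul_pos_right
    ((norm_pos_iff.2 (slitPlane_ne_zero hslit)).trans_le hcY.le_height) hκ.le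
  exact ⟨c, Y, by simpa using hcY.conj hslit hY (hK.trans_le hcY.le_right)⟩

end SaddlePath

lemma norm_threeSideIntegral_le {f : ℂ → ℂ} {a c Y ρ B₁ B₂ : ℝ} (hρ : 0 < ρ) (hac : a ≤ c)
    (hY : 0 ≤ Y) (hB₁ : 0 ≤ B₁)
    (hhor : ∀ x ≤ c, ∀ y : ℝ, |y| = Y → ‖f (x + y * I)‖ ≤ B₁ / (1 + (x / ρ) ^ 2))
    (hver : ∀ y : ℝ, |y| ≤ Y → ‖f (c + y * I)‖ ≤ B₂) :
    ‖threeSideIntegral f a c Y‖ ≤ 2 * (Real.pi * ρ * B₁) + 2 * Y * B₂ := by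
  have hint : MeasureTheory.Integrable (fun x : ℝ => B₁ / (1 + (x / ρ) ^ 2)) := by
    simpa [div_eq_mul_inv] using! (integrable_inv_one_add_sq.comp_div hρ.ne').const_mul B₁
  have htotal : ∫ x : ℝ, B₁ / (1 + (x / ρ) ^ 2) = Real.pi * ρ * B₁ := by
    have h := MeasureTheory.Measure.integral_comp_div (fun x : ℝ => (1 + x ^ 2)⁻¹) ρ
    rw [integral_univ_inv_one_add_sq, abs_of_pos hρ, smul_eq_mul] at h
    simp only [div_eq_mul_inv B₁]
    rw [MeasureTheory.integral_const_mul, h]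
    ring
  have hside {y : ℝ} (hy : |y| = Y) : ‖∫ x : ℝ in a..c, f (x + y * I)‖ ≤ Real.pi * ρ * B₁ := by
    refine (intervalIntegral.norm_integral_le_of_norm_le hac
      (MeasureTheory.ae_of_all _ fun x hx => hhor x hx.2 y hy) hint.intervalIntegrable).trans ?_
    rw [intervalIntegral.integral_of_le hac, ← htotal]
    exact MeasureTheory.setIntegral_le_integral hint
      (MeasureTheory.ae_of_all _ fun x => by positivity)
  have hright : ‖I * ∫ y : ℝ in -Y..Y, f (c + y * I)‖ ≤ 2 * Y * B₂ := by
    rw [norm_mul, norm_I, one_mul]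
    refine (intervalIntegral.norm_integral_le_of_norm_le_const (C := B₂) fun y hy => ?_).trans ?_
    · rw [uIoc_of_le (by linarith)] at hy
      exact hver y (abs_le.2 ⟨hy.1.le, hy.2⟩)
    · rw [sub_neg_eq_add, abs_of_nonneg (by linarith)]
      exact le_of_eq (by ring)
  have hlow := hside (y := -Y) (by rw [abs_neg, abs_of_nonneg hY])
  have hup := hside (abs_of_nonneg hY)
  exact (norm_add_le _ _).trans (add_le_add ((norm_sub_le _ _).trans (by linarith)) hright)

section SaddleBound

variable {f : ℂ → ℂ} {S : ℂ} {κ K C a c Y : ℝ}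

lemma exp_gammaExponent_eq (S : ℂ) (E : ℝ) :
    Real.exp E = Real.exp (E + S.re) * Real.exp (-S.re) := by
  rw [← Real.exp_add, add_neg_cancel_right]

lemma IsSaddleRectangle.norm_horizontal_le (h : IsSaddleRectangle κ K S c Y) (hκ : 0 < κ)
    (hC : 0 ≤ C) (hK : 0 < K) (hKY : K ≤ Y)
    (hf : ∀ w, K ≤ negAxisDist w →
      ‖f w‖ ≤ C * (negAxisDist w)⁻¹ ^ 2 * Real.exp (gammaExponent (log S) w))
    {x y : ℝ} (hx : x ≤ c) (hy : |y| = Y) :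
    ‖f (x + y * I)‖ ≤
      C * κ ^ 3 / ‖S‖ ^ 2 * Real.exp (-S.re) / (1 + (x / ‖S‖) ^ 2) := by
  have hY : 0 < Y := hK.trans_le hKY
  have hS : 0 < ‖S‖ := hY.trans_le h.height_le
  have hdist : ‖S‖ / κ ≤ negAxisDist (x + y * I) := calc
    ‖S‖ / κ ≤ Y := (div_le_iff₀' hκ).2 h.le_height
    _ ≤ negAxisDist (x + y * I) := by simpa [hy] using abs_im_le_negAxisDist (x + y * I)
  have hfar : K ≤ negAxisDist (x + y * I) :=
    hKY.trans (by simpa [hy] using abs_im_le_negAxisDist (x + y * I))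
  have hpos : 0 < negAxisDist (x + y * I) := hK.trans_le hfar
  refine (hf _ hfar).trans ?_
  rw [exp_gammaExponent_eq S]
  calc _ ≤ C * (‖S‖ / κ)⁻¹ ^ 2 * (κ / (1 + (x / ‖S‖) ^ 2) * Real.exp (-S.re)) := by
        gcongr
        exact h.horizontal x hx y hy
    _ = _ := by
        field_simp

lemma IsSaddleRectangle.norm_vertical_le (h : IsSaddleRectangle κ K S c Y)
    (hC : 0 ≤ C) (hK : 0 < K)
    (hf : ∀ w, K ≤ negAxisDist w →
      ‖f w‖ ≤ C * (negAxisDist w)⁻¹ ^ 2 * Real.exp (gammaExponent (log S) w))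
    {y : ℝ} (hy : |y| ≤ Y) :
    ‖f (c + y * I)‖ ≤ 4 * C * κ / ‖S‖ ^ 2 * Real.exp (-S.re) := by
  set w : ℂ := c + y * I
  have hc : 0 < c := hK.trans_le h.le_right
  have hre : c ≤ negAxisDist w := by simpa [w] using re_le_negAxisDist w
  have him : |y| ≤ negAxisDist w := by simpa [w] using abs_im_le_negAxisDist w
  have hpos : 0 < negAxisDist w := hc.trans_le hre
  have hw : 0 < ‖w‖ := hpos.trans_le (negAxisDist_le_norm w)
  have hdist : ‖w‖ / 2 ≤ negAxisDist w := by
    have hsum : ‖w‖ ≤ |c| + |y| := by simpa [w] using norm_le_abs_re_add_abs_im w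
    rw [abs_of_pos hc] at hsum
    linarith
  refine (hf _ (h.le_right.trans hre)).trans ?_
  rw [exp_gammaExponent_eq S]
  calc _ ≤ C * (‖w‖ / 2)⁻¹ ^ 2 * (κ * (‖w‖ / ‖S‖) ^ 2 * Real.exp (-S.re)) := by
        gcongr
        exact h.vertical y hy
    _ = _ := by
        field_simp
        ring

lemma IsSaddleRectangle.norm_threeSideIntegral_le (h : IsSaddleRectangle κ K S c Y) (hκ : 0 < κ)
    (hC : 0 ≤ C) (hK : 0 < K) (hKY : K ≤ Y) (hac : a ≤ c)
    (hf : ∀ w, K ≤ negAxisDist w →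
      ‖f w‖ ≤ C * (negAxisDist w)⁻¹ ^ 2 * Real.exp (gammaExponent (log S) w)) :
    ‖threeSideIntegral f a c Y‖ ≤
      (2 * Real.pi * C * κ ^ 3 + 8 * C * κ) / ‖S‖ * Real.exp (-S.re) := by
  have hY : 0 < Y := hK.trans_le hKY
  have hS : 0 < ‖S‖ := hY.trans_le h.height_le
  refine (QuantumPn.norm_threeSideIntegral_le hS hac hY.le (by positivity)
    (fun x hx y hy => h.norm_horizontal_le hκ hC hK hKY hf hx hy)
    (fun y hy => h.norm_vertical_le hC hK hf hy)).trans ?_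
  calc _ ≤ 2 * (Real.pi * ‖S‖ * (C * κ ^ 3 / ‖S‖ ^ 2 * Real.exp (-S.re))) +
        2 * ‖S‖ * (4 * C * κ / ‖S‖ ^ 2 * Real.exp (-S.re)) := by
        gcongr
        exact h.height_le
    _ = _ := by
        field_simp
        ring

end SaddleBound

section Error

variable {n : ℕ} {α : Fin n → ℂ} {X c Y : ℝ}

lemma exists_generic_abscissa (hn : 0 < n) (x : Fin n → ℝ) :
    ∃ X : ℝ, (∀ a, ∀ j : ℤ, x a - X / n ≠ j) ∧ ∀ j : ℤ, X ≠ j := by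
  have hn' : (n : ℝ) ≠ 0 := Nat.cast_ne_zero.2 hn.ne'
  have hcount : ((⋃ a, range fun j : ℤ => n * (x a - j)) ∪
      range fun j : ℤ => (j : ℝ)).Countable :=
    (countable_iUnion fun _ => countable_range _).union (countable_range _)
  obtain ⟨X, hX⟩ := (hcount.dense_compl ℝ).nonempty
  refine ⟨X, fun a j h => hX (.inl (mem_iUnion.2 ⟨a, j, ?_⟩)), fun j h => hX (.inr ⟨j, h.symm⟩)⟩
  simp only [← h]
  field_simp
  ring

lemma isPoleFreeFrame_of_norm_lt (hX : ∀ a, ∀ j : ℤ, (α a).re - X / n ≠ j)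
    (hc : n * ∑ a, ‖α a‖ < c) (hY : n * ∑ a, ‖α a‖ < Y) : IsPoleFreeFrame α X c Y where
  left := hX
  right a := calc
    -(n * (α a).re) = n * -(α a).re := by ring
    _ ≤ n * ∑ a, ‖α a‖ := by
      gcongr
      exact (neg_le_abs _).trans ((abs_re_le_norm _).trans (norm_le_sum_norm α a))
    _ < c := hc
  height a := by
    refine lt_of_le_of_lt ?_ hY
    gcongr
    exact (abs_im_le_norm _).trans (norm_le_sum_norm α a)

lemma isPoleFreeFrame_one {b : ℤ} (hX : ∀ j : ℤ, X ≠ j) (hc : -b < c) (hY : 0 < Y) :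
    IsPoleFreeFrame (fun _ : Fin 1 => (b : ℂ)) X c Y where
  left _ j h := hX (b - j) (by
    simp only [intCast_re, Nat.cast_one, div_one] at h
    push_cast
    linarith)
  right _ := by simpa using hc
  height _ := by simpa using hY

/-- The function `e^{-(ℓ - log n)w} ∏_a Γ(α_a + w/n)` minus the first two terms of its
expansion in terms of `e^{-ℓw} Γ(w)` and `e^{-ℓw} Γ(w - 1)`. -/
def gammaKernelError (α : Fin n → ℂ) (ℓ w : ℂ) : ℂ :=
  gammaKernel α (ℓ - Real.log n) w - gaussConst n * gammaKernel (fun _ : Fin 1 => 0) ℓ w -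
    gaussConst n * gammaRatioCoeff α * gammaKernel (fun _ : Fin 1 => -1) ℓ w

lemma gammaKernelError_eq (α : Fin n → ℂ) (ℓ w : ℂ) : gammaKernelError α ℓ w =
    exp (-((ℓ - Real.log n) * w)) * (∏ a, Gamma (α a + w / n) -
      gaussConst n * exp (-(w * Real.log n)) * (Gamma w + gammaRatioCoeff α * Gamma (w - 1))) := by
  have hexp : exp (-(ℓ * w)) = exp (-((ℓ - Real.log n) * w)) * exp (-(w * Real.log n)) := by
    rw [← exp_add]
    ring_nf
  rw [gammaKernelError, gammaKernel_one, gammaKernel_one, gammaKernel, zero_add, neg_add_eq_sub,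
    hexp]
  ring

lemma exists_norm_gammaKernelError_le (hn : 0 < n) (hα : ∑ a, α a = ((n : ℂ) - 1) / 2) :
    ∃ C K : ℝ, 0 ≤ C ∧ ∀ ℓ w, K ≤ negAxisDist w → ‖gammaKernelError α ℓ w‖ ≤
      C * (negAxisDist w)⁻¹ ^ 2 * Real.exp (gammaExponent ℓ w) := by
  obtain ⟨C₁, hC₁, hprod⟩ := (prod_Gamma_sub_isBigO hn hα).exists_pos
  obtain ⟨C₂, hC₂, hGamma⟩ := exists_norm_exp_mul_Gamma_le
  obtain ⟨K, hK⟩ := eventually_atTop.1 (eventually_comap.1 (hprod.bound.and hGamma))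
  refine ⟨C₁ * C₂, K, by positivity, fun ℓ w hw => ?_⟩
  obtain ⟨hprod, hGamma⟩ := hK _ hw w rfl
  have hexp : exp (-((ℓ - Real.log n) * w)) * (exp (-(w * Real.log n)) * Gamma w) =
      exp (-(ℓ * w)) * Gamma w := by
    rw [← mul_assoc, ← exp_add]
    ring_nf
  rw [gammaKernelError_eq, norm_mul]
  calc _ ≤ ‖exp (-((ℓ - Real.log n) * w))‖ *
        (C₁ * ‖exp (-(w * Real.log n)) * Gamma w * ((negAxisDist w)⁻¹ ^ 2 : ℝ)‖) := by gcongr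
    _ = C₁ * (negAxisDist w)⁻¹ ^ 2 * ‖exp (-(ℓ * w)) * Gamma w‖ := by
      rw [norm_mul _ (((negAxisDist w)⁻¹ ^ 2 : ℝ) : ℂ), norm_real,
        Real.norm_of_nonneg (by positivity), ← hexp, norm_mul _ (exp _ * Gamma w)]
      ring
    _ ≤ C₁ * (negAxisDist w)⁻¹ ^ 2 * (C₂ * Real.exp (gammaExponent ℓ w)) := by
      gcongr
      exact hGamma ℓ
    _ = _ := by ring

lemma IsPoleFreeFrame.tendsto_threeSideIntegral_one {b : ℤ}
    (h : IsPoleFreeFrame (fun _ : Fin 1 => (b : ℂ)) X c Y) (hn : 0 < n) (ℓ : ℂ) :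
    Tendsto (fun N : ℕ =>
      threeSideIntegral (gammaKernel (fun _ : Fin 1 => (b : ℂ)) ℓ) (-(X + n * N)) c Y) atTop
      (𝓝 (2 * Real.pi * I * (exp (ℓ * b) * exp (-exp ℓ)))) := by
  have hlim := h.tendsto_threeSideIntegral (ℓ := ℓ) one_pos
    fun a a' hne => absurd (Subsingleton.elim a a') hne
  rw [tsum_gammaResidue_one] at hlim
  simpa [Function.comp_def] using hlim.comp (tendsto_id.const_mul_atTop' hn)

lemma IsPoleFreeFrame.continuousOn_gammaKernel_one {b : ℤ}
    (h : IsPoleFreeFrame (fun _ : Fin 1 => (b : ℂ)) X c Y) (n N : ℕ) (ℓ : ℂ) :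
    ContinuousOn (gammaKernel (fun _ : Fin 1 => (b : ℂ)) ℓ) (rectFrame (-(X + n * N)) c Y) := by
  simpa using h.continuousOn_gammaKernel (ℓ := ℓ) one_pos (n * N)

lemma threeSideIntegral_gammaKernelError (hn : 0 < n) (h : IsPoleFreeFrame α X c Y)
    (h₀ : IsPoleFreeFrame (fun _ : Fin 1 => ((0 : ℤ) : ℂ)) X c Y)
    (h₁ : IsPoleFreeFrame (fun _ : Fin 1 => ((-1 : ℤ) : ℂ)) X c Y) (ℓ : ℂ) {N : ℕ}
    (hN : -(X + n * N) ≤ c) :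
    threeSideIntegral (gammaKernelError α ℓ) (-(X + n * N)) c Y =
      threeSideIntegral (gammaKernel α (ℓ - Real.log n)) (-(X + n * N)) c Y -
        gaussConst n * threeSideIntegral (gammaKernel (fun _ : Fin 1 => ((0 : ℤ) : ℂ)) ℓ)
          (-(X + n * N)) c Y -
        gaussConst n * gammaRatioCoeff α *
          threeSideIntegral (gammaKernel (fun _ : Fin 1 => ((-1 : ℤ) : ℂ)) ℓ)
            (-(X + n * N)) c Y := by
  have hY := (h.height_pos hn).le
  have hcont := h.continuousOn_gammaKernel (ℓ := ℓ - Real.log n) hn N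
  have hcont₀ := (h₀.continuousOn_gammaKernel_one n N ℓ).const_mul (gaussConst n : ℂ)
  have hcont₁ := (h₁.continuousOn_gammaKernel_one n N ℓ).const_mul
    (gaussConst n * gammaRatioCoeff α)
  rw [← threeSideIntegral_const_mul, ← threeSideIntegral_const_mul,
    ← threeSideIntegral_sub hcont hcont₀ hN hY,
    ← threeSideIntegral_sub (hcont.fun_sub hcont₀) hcont₁ hN hY]
  simp only [Int.cast_zero, Int.cast_neg, Int.cast_one]
  rfl

lemma tendsto_threeSideIntegral_gammaKernelError (hn : 0 < n)
    (hα : ∀ a b, a ≠ b → ∀ k : ℤ, α a - α b ≠ k) (h : IsPoleFreeFrame α X c Y)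
    (h₀ : IsPoleFreeFrame (fun _ : Fin 1 => ((0 : ℤ) : ℂ)) X c Y)
    (h₁ : IsPoleFreeFrame (fun _ : Fin 1 => ((-1 : ℤ) : ℂ)) X c Y) (ℓ : ℂ) :
    Tendsto (fun N : ℕ => threeSideIntegral (gammaKernelError α ℓ) (-(X + n * N)) c Y) atTop
      (𝓝 (2 * Real.pi * I * ((∑ J, ∑' k, gammaResidue α (ℓ - Real.log n) J k) -
        gaussConst n * exp (-exp ℓ) -
          gaussConst n * gammaRatioCoeff α * (exp (-ℓ) * exp (-exp ℓ))))) := by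
  have hlim := ((h.tendsto_threeSideIntegral (ℓ := ℓ - Real.log n) hn hα).sub
    ((h₀.tendsto_threeSideIntegral_one hn ℓ).const_mul (gaussConst n : ℂ))).sub
    ((h₁.tendsto_threeSideIntegral_one hn ℓ).const_mul (gaussConst n * gammaRatioCoeff α))
  refine (hlim.congr' ?_).trans (le_of_eq ?_)
  · filter_upwards [eventually_neg_add_natCast_mul_le hn X c] with N hN
    exact (threeSideIntegral_gammaKernelError hn h h₀ h₁ ℓ hN).symm
  · congr 1
    simp only [Int.cast_zero, Int.cast_neg, Int.cast_one, mul_zero, exp_zero, one_mul, mul_neg,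
      mul_one]
    ring

lemma norm_sum_gammaResidue_sub_le {κ K C : ℝ} {S : ℂ} (hn : 0 < n)
    (hα : ∀ a b, a ≠ b → ∀ k : ℤ, α a - α b ≠ k) (hκ : 0 < κ) (hC : 0 ≤ C)
    (hK : n * ∑ a, ‖α a‖ + 1 < K) (hKY : K ≤ Y) (hrect : IsSaddleRectangle κ K S c Y)
    (hf : ∀ w, K ≤ negAxisDist w → ‖gammaKernelError α (log S) w‖ ≤
      C * (negAxisDist w)⁻¹ ^ 2 * Real.exp (gammaExponent (log S) w)) :
    ‖(∑ J, ∑' k, gammaResidue α (log S - Real.log n) J k) - gaussConst n * exp (-S)‖ ≤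
      (2 * Real.pi * C * κ ^ 3 + 8 * C * κ + ‖gaussConst n * gammaRatioCoeff α‖) / ‖S‖ *
        ‖exp (-S)‖ := by
  have hsum : 0 ≤ n * ∑ a, ‖α a‖ := by positivity
  have hKc := hrect.le_right
  obtain ⟨X, hX, hX'⟩ := exists_generic_abscissa hn fun a => (α a).re
  have hS : S ≠ 0 := norm_pos_iff.1 (by linarith [hrect.height_le])
  have hlim := tendsto_threeSideIntegral_gammaKernelError hn hα
    (isPoleFreeFrame_of_norm_lt hX (by linarith) (by linarith))
    (isPoleFreeFrame_one hX' (by push_cast; linarith) (by linarith))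
    (isPoleFreeFrame_one (c := c) (Y := Y) hX' (by push_cast; linarith) (by linarith)) (log S)
  have hbound := le_of_tendsto hlim.norm
    ((eventually_neg_add_natCast_mul_le hn X c).mono fun N hN =>
      hrect.norm_threeSideIntegral_le hκ hC (by linarith) hKY hN hf)
  have hpi : 1 ≤ ‖(2 * Real.pi * I : ℂ)‖ := by
    simp only [norm_mul, norm_I, norm_real, Real.norm_of_nonneg Real.pi_nonneg, norm_ofNat]
    linarith [Real.pi_gt_three]
  rw [norm_mul, exp_log hS] at hbound
  have hsecond : ‖gaussConst n * gammaRatioCoeff α * (exp (-log S) * exp (-S))‖ =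
      ‖gaussConst n * gammaRatioCoeff α‖ / ‖S‖ * ‖exp (-S)‖ := by
    rw [norm_mul, norm_mul (exp _), exp_neg, exp_log hS, norm_inv]
    ring
  refine (norm_le_norm_sub_add _
    (gaussConst n * gammaRatioCoeff α * (exp (-log S) * exp (-S)))).trans ?_
  rw [hsecond, add_div, add_mul, norm_exp (-S), neg_re]
  gcongr
  exact (le_mul_of_one_le_left (norm_nonneg _) hpi).trans hbound

theorem exists_norm_sum_gammaResidue_sub_le (hn : 0 < n)
    (hα : ∀ a b, a ≠ b → ∀ k : ℤ, α a - α b ≠ k) (hsum : ∑ a, α a = ((n : ℂ) - 1) / 2) {u : ℂ}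
    (hu : ‖u‖ = 1) (hs : u ∈ slitPlane) :
    ∃ C : ℝ, ∀ᶠ ρ : ℝ in atTop,
      ‖(∑ J, ∑' k, gammaResidue α (log (ρ * u) - Real.log n) J k) -
        gaussConst n * exp (-(ρ * u))‖ ≤ C / ρ * ‖exp (-(ρ * u))‖ := by
  obtain ⟨C, K₀, hC, hf⟩ := exists_norm_gammaKernelError_le hn hsum
  set K := max K₀ (n * ∑ a, ‖α a‖ + 2)
  have hK : n * ∑ a, ‖α a‖ + 2 ≤ K := le_max_right _ _
  have hK0 : 0 < K := lt_of_lt_of_le (by positivity) hK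
  obtain ⟨κ, hκ, hrect⟩ := exists_isSaddleRectangle hu hs hK0
  refine ⟨2 * Real.pi * C * κ ^ 3 + 8 * C * κ + ‖gaussConst n * gammaRatioCoeff α‖, ?_⟩
  filter_upwards [hrect, eventually_ge_atTop (κ * K)] with ρ ⟨c, Y, hcY⟩ hρ
  have hnorm : ‖(ρ * u : ℂ)‖ = ρ := by
    have hρ0 : 0 ≤ ρ := (by positivity : 0 ≤ κ * K).trans hρ
    rw [norm_mul, hu, mul_one, norm_real, Real.norm_of_nonneg hρ0]
  have hKY : K ≤ Y := le_of_mul_le_mul_left (hρ.trans (hnorm ▸ hcY.le_height)) hκ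
  simpa only [hnorm] using norm_sum_gammaResidue_sub_le hn hα hκ hC (by linarith) hKY hcY
    fun w hw => hf _ w ((le_max_left _ _).trans hw)

end Error

section ShiftParam

variable {n : ℕ} {α : Fin n → ℂ} {ℓ : ℂ}

/-- The Gamma parameters `α`, raised by `1` at the indices in `s`. Since `Γ(x + 1) = x Γ(x)`, this
multiplies the kernel by a polynomial. -/
def shiftParam (s : Finset (Fin n)) (α : Fin n → ℂ) (a : Fin n) : ℂ :=
  α a + if a ∈ s then 1 else 0

lemma shiftParam_sub_ne (hα : ∀ a b, a ≠ b → ∀ k : ℤ, α a - α b ≠ k) (s : Finset (Fin n))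
    (a b : Fin n) (hab : a ≠ b) (k : ℤ) : shiftParam s α a - shiftParam s α b ≠ k := by
  intro h
  refine hα a b hab (k - (if a ∈ s then 1 else 0) + if b ∈ s then 1 else 0) ?_
  push_cast
  simp only [shiftParam] at h
  linear_combination h

lemma sum_shiftParam (s : Finset (Fin n)) : ∑ a, shiftParam s α a = ∑ a, α a + s.card := by
  simp only [shiftParam, Finset.sum_add_distrib, Finset.sum_boole, Finset.filter_univ_mem]

lemma prod_Gamma_shiftParam_sub (hα : ∀ a b, a ≠ b → ∀ k : ℤ, α a - α b ≠ k)
    (s : Finset (Fin n)) (J : Fin n) (k : ℕ) :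
    ∏ a ∈ Finset.univ.erase J, Gamma (shiftParam s α a - α J - k) =
      (∏ a ∈ s.erase J, (α a - α J - k)) *
        ∏ a ∈ Finset.univ.erase J, Gamma (α a - α J - k) := by
  rw [← Finset.univ_inter s, ← Finset.erase_inter, ← Finset.prod_ite_mem,
    ← Finset.prod_mul_distrib]
  refine Finset.prod_congr rfl fun a ha => ?_
  have hne : α a - α J - k ≠ 0 := fun h => by
    refine hα a J (Finset.ne_of_mem_erase ha) k ?_
    push_cast
    linear_combination h
  by_cases has : a ∈ s
  · simp only [shiftParam, Finset.univ_inter, has, if_true]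
    rw [← Gamma_add_one _ hne]
    congr 1; ring
  · simp [shiftParam, has]

lemma gammaResidue_shiftParam_of_notMem (hα : ∀ a b, a ≠ b → ∀ k : ℤ, α a - α b ≠ k)
    {s : Finset (Fin n)} {J : Fin n} (hJ : J ∉ s) (k : ℕ) :
    gammaResidue (shiftParam s α) ℓ J k = (∏ a ∈ s, (α a - α J - k)) * gammaResidue α ℓ J k := by
  have hself : shiftParam s α J = α J := by simp [shiftParam, hJ]
  rw [gammaResidue, gammaResidue, hself, prod_Gamma_shiftParam_sub hα,
    Finset.erase_eq_of_notMem hJ]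
  ring

lemma gammaResidue_shiftParam_of_mem (hα : ∀ a b, a ≠ b → ∀ k : ℤ, α a - α b ≠ k)
    {s : Finset (Fin n)} {J : Fin n} (hJ : J ∈ s) (k : ℕ) :
    gammaResidue (shiftParam s α) ℓ J k =
      (∏ a ∈ s, (α a - α J - (k + 1 : ℕ))) * gammaResidue α ℓ J (k + 1) := by
  have hself : shiftParam s α J + k = α J + (k + 1 : ℕ) := by
    simp only [shiftParam, hJ, if_true]; push_cast; ring
  have hsub (a : Fin n) :
      shiftParam s α a - shiftParam s α J - k = shiftParam s α a - α J - (k + 1 : ℕ) := by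
    linear_combination -hself
  have hk : (k : ℂ) + 1 ≠ 0 := Nat.cast_add_one_ne_zero k
  simp only [gammaResidue, hself, hsub]
  rw [prod_Gamma_shiftParam_sub hα, ← Finset.mul_prod_erase s _ hJ, Nat.factorial_succ, pow_succ]
  push_cast
  field_simp
  ring

lemma hasSum_prod_mul_gammaResidue (hn : 0 < n) (hα : ∀ a b, a ≠ b → ∀ k : ℤ, α a - α b ≠ k)
    (s : Finset (Fin n)) (J : Fin n) :
    HasSum (fun k : ℕ => (∏ a ∈ s, (α a - α J - k)) * gammaResidue α ℓ J k)
      (∑' k, gammaResidue (shiftParam s α) ℓ J k) := by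
  have hsum := (summable_gammaResidue (ℓ := ℓ) hn (shiftParam_sub_ne hα s) J).hasSum
  by_cases hJ : J ∈ s
  · have hzero : ∏ a ∈ s, (α a - α J - (0 : ℕ)) = 0 := Finset.prod_eq_zero hJ (by simp)
    refine (hasSum_nat_add_iff' 1).1 ?_
    rw [Finset.sum_range_one, hzero, zero_mul, sub_zero]
    exact hsum.congr_fun fun k => (gammaResidue_shiftParam_of_mem hα hJ k).symm
  · exact hsum.congr_fun fun k => (gammaResidue_shiftParam_of_notMem hα hJ k).symm

lemma gammaResidue_of_mul_eq_add {L : ℂ} {q : ℤ} (hL : n * L = n * ℓ + q * (2 * Real.pi * I))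
    (J : Fin n) (k : ℕ) :
    gammaResidue α L J k = exp (q * (2 * Real.pi * I) * α J) * gammaResidue α ℓ J k := by
  have hexp : exp (L * (n * (α J + k))) =
      exp (q * (2 * Real.pi * I) * α J) * exp (ℓ * (n * (α J + k))) := by
    have hadd : L * (n * (α J + k)) = q * (2 * Real.pi * I) * α J + ℓ * (n * (α J + k)) +
        (q * k : ℤ) * (2 * Real.pi * I) := by
      push_cast
      linear_combination (α J + k) * hL
    rw [hadd, exp_add, exp_int_mul_two_pi_mul_I, mul_one, exp_add]
  rw [gammaResidue, gammaResidue, hexp]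
  ring

lemma exp_intCast_mul_shiftParam (s : Finset (Fin n)) (J : Fin n) (q : ℤ) :
    exp (q * (2 * Real.pi * I) * shiftParam s α J) = exp (q * (2 * Real.pi * I) * α J) := by
  have hadd : q * (2 * Real.pi * I) * shiftParam s α J = q * (2 * Real.pi * I) * α J +
      (q * if J ∈ s then 1 else 0 : ℤ) * (2 * Real.pi * I) := by
    rw [shiftParam]
    push_cast
    ring
  rw [hadd, exp_add, exp_int_mul_two_pi_mul_I, mul_one]

end ShiftParam

lemma residue_eq_of_tendsto {E : Type*} [NormedAddCommGroup E] [NormedSpace ℂ E] [CompleteSpace E]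
    {f : ℂ → E} {c : ℂ} {v : E} (hf : ∀ᶠ t in 𝓝[≠] c, DifferentiableAt ℂ f t)
    (hv : Tendsto (fun t => (t - c) • f t) (𝓝[≠] c) (𝓝 v)) : residue f c = v := by
  set g : ℂ → E := Function.update (fun t => (t - c) • f t) c v
  obtain ⟨δ, hδ, hball⟩ := Metric.eventually_nhds_iff_ball.1 (eventually_nhdsWithin_iff.1 hf)
  have hg_of_ne : ∀ t, t ≠ c → g t = (t - c) • f t := fun t ht => Function.update_of_ne ht _ _
  have hg_self : g c = v := Function.update_self _ _ _
  have hg_diff : DifferentiableOn ℂ g (Metric.ball c δ) := by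
    rw [← differentiableOn_compl_singleton_and_continuousAt_iff (Metric.ball_mem_nhds c hδ)]
    refine ⟨fun t ht => ?_, continuousAt_update_same.2 hv⟩
    have hsmul : DifferentiableAt ℂ (fun t => (t - c) • f t) t :=
      DifferentiableAt.fun_smul (by fun_prop) (hball t ht.1 ht.2)
    refine (hsmul.congr_of_eventuallyEq ?_).differentiableWithinAt
    filter_upwards [isOpen_compl_singleton.mem_nhds ht.2] with s hs using hg_of_ne s hs
  refine Tendsto.limUnder_eq (tendsto_const_nhds.congr' ?_)
  filter_upwards [Ioo_mem_nhdsGT hδ] with ε hε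
  have hcauchy := (hg_diff.mono (Metric.closedBall_subset_ball hε.2)).circleIntegral_sub_inv_smul
    (Metric.mem_ball_self hε.1)
  have hcongr : (∮ t in C(c, ε), f t) = ∮ t in C(c, ε), (t - c)⁻¹ • g t := by
    refine circleIntegral.integral_congr hε.1.le fun t ht => ?_
    have htc : t ≠ c := Metric.ne_of_mem_sphere ht hε.1.ne'
    rw [hg_of_ne t htc, inv_smul_smul₀ (sub_ne_zero.2 htc)]
  rw [hcongr, hcauchy, inv_smul_smul₀ two_pi_I_ne_zero, hg_self]

namespace EqCohomology

variable {n : ℕ} (z : Fin n → ℂ)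

instance : FiniteDimensional ℂ (EqCohomology z) := Module.Finite.of_basis (basis z)

instance : CompleteSpace (EqCohomology z) := FiniteDimensional.complete ℂ _

lemma eval_weightPoly (b : Fin n) : (weightPoly z).eval (z b) = 0 := by
  rw [weightPoly, eval_prod]
  exact Finset.prod_eq_zero (Finset.mem_univ b) (by simp)

/-- The restriction to the `b`-th fixed point of the torus, `x ↦ z_b`. -/
def evalAt (b : Fin n) : EqCohomology z →ₐ[ℂ] ℂ :=
  (AdjoinRoot.liftAlgHom (weightPoly z) (Algebra.ofId ℂ ℂ) (z b) (eval_weightPoly z b) :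
    AdjoinRoot (weightPoly z) →ₐ[ℂ] ℂ)

/-- The class of a polynomial in `x`. -/
def ofPoly : ℂ[X] →+* EqCohomology z := AdjoinRoot.mk (weightPoly z)

lemma evalAt_ofPoly (b : Fin n) (p : ℂ[X]) : evalAt z b (ofPoly z p) = p.eval (z b) :=
  (AdjoinRoot.lift_mk (i := algebraMap ℂ ℂ) (eval_weightPoly z b) p).trans
    (by rw [Algebra.algebraMap_self, eval])

lemma evalAt_x (b : Fin n) : evalAt z b (x z) = z b :=
  (evalAt_ofPoly z b X).trans eval_X

variable {z}

lemma eq_of_forall_evalAt (hz : Function.Injective z) {h h' : EqCohomology z}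
    (heq : ∀ b, evalAt z b h = evalAt z b h') : h = h' := by
  obtain ⟨p, rfl⟩ : ∃ p, ofPoly z p = h := AdjoinRoot.mk_surjective h
  obtain ⟨q, rfl⟩ : ∃ p, ofPoly z p = h' := AdjoinRoot.mk_surjective h'
  rw [← sub_eq_zero, ← map_sub]
  refine AdjoinRoot.mk_eq_zero.2 (Finset.prod_dvd_of_coprime ?_ fun b _ => ?_)
  · exact (pairwise_coprime_X_sub_C hz).set_pairwise _
  · rw [dvd_iff_isRoot, IsRoot.def, eval_sub, sub_eq_zero, ← evalAt_ofPoly, ← evalAt_ofPoly, heq]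

variable (z) in
/-- The class that restricts to `1` at the `b`-th fixed point and to `0` at the others. -/
def idem (b : Fin n) : EqCohomology z := ofPoly z (Lagrange.basis Finset.univ z b)

lemma evalAt_idem (hz : Function.Injective z) (a b : Fin n) :
    evalAt z a (idem z b) = if a = b then 1 else 0 := by
  rw [idem, evalAt_ofPoly]
  split_ifs with h
  · rw [h, Lagrange.eval_basis_self hz.injOn (Finset.mem_univ b)]
  · exact Lagrange.eval_basis_of_ne (Ne.symm h) (Finset.mem_univ a)

lemma evalAt_sum_smul_idem (hz : Function.Injective z) (b : Fin n) (v : Fin n → ℂ) :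
    evalAt z b (∑ a, v a • idem z a) = v b := by
  simp [evalAt_idem hz]

lemma eq_sum_evalAt_smul_idem (hz : Function.Injective z) (h : EqCohomology z) :
    h = ∑ b, evalAt z b h • idem z b :=
  eq_of_forall_evalAt hz fun b => (evalAt_sum_smul_idem hz b fun a => evalAt z a h).symm

lemma evalAt_tsum (hz : Function.Injective z) {ι : Type*} {f : ι → EqCohomology z} {v : Fin n → ℂ}
    (hf : ∀ b, HasSum (fun i => evalAt z b (f i)) (v b)) (b : Fin n) :
    evalAt z b (∑' i, f i) = v b := by
  have hsum : HasSum f (∑ b, v b • idem z b) := by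
    rw [funext fun i => eq_sum_evalAt_smul_idem hz (f i)]
    exact hasSum_sum fun b _ => (hf b).smul_const (idem z b)
  rw [hsum.tsum_eq, evalAt_sum_smul_idem hz]

lemma map_evalAt_chernRootPoly (b : Fin n) :
    (chernRootPoly z).map (evalAt z b : EqCohomology z →+* ℂ) =
      ∏ a ∈ Finset.univ.erase b, (X - C (z a)) := by
  have hmap := congrArg (Polynomial.map (evalAt z b : EqCohomology z →+* ℂ))
    (X_sub_C_x_mul_chernRootPoly z)
  rw [Polynomial.map_mul, Polynomial.map_sub, map_X, map_C, Polynomial.map_map, RingHom.coe_coe,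
    evalAt_x, AlgHom.comp_algebraMap, Algebra.algebraMap_self, Polynomial.map_id, weightPoly,
    ← Finset.mul_prod_erase Finset.univ _ (Finset.mem_univ b)] at hmap
  exact mul_left_cancel₀ (X_sub_C_ne_zero (z b)) hmap

lemma card_univ_erase (b : Fin n) : (Finset.univ.erase b).card = n - 1 := by
  rw [Finset.card_erase_of_mem (Finset.mem_univ b), Finset.card_univ, Fintype.card_fin]

lemma evalAt_W (b : Fin n) (t : ℂ) :
    evalAt z b (W z t) = ∏ a ∈ Finset.univ.erase b, (z a - t) := by
  have heval : evalAt z b ((chernRootPoly z).eval (algebraMap ℂ (EqCohomology z) t)) =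
      ∏ a ∈ Finset.univ.erase b, (t - z a) := by
    have hmap := eval_map_apply (evalAt z b : EqCohomology z →+* ℂ) (p := chernRootPoly z)
      (algebraMap ℂ (EqCohomology z) t)
    rw [map_evalAt_chernRootPoly, RingHom.coe_coe, AlgHom.commutes, Algebra.algebraMap_self,
      RingHom.id_apply, eval_prod] at hmap
    simpa only [eval_sub, eval_X, eval_C] using hmap.symm
  rw [W, map_mul, map_pow, map_neg, map_one, heval, ← card_univ_erase b, ← Finset.prod_const,
    ← Finset.prod_mul_distrib]
  exact Finset.prod_congr rfl fun a _ => by ring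

lemma differentiable_W : Differentiable ℂ (W z) := by
  have hpoly : W z = fun t => ∑ i ∈ Finset.range ((chernRootPoly z).natDegree + 1),
      t ^ i • ((-1) ^ (n - 1) * (chernRootPoly z).coeff i) := by
    funext t
    rw [W, eval_eq_sum_range, Finset.mul_sum]
    refine Finset.sum_congr rfl fun i _ => ?_
    rw [← map_pow, Algebra.smul_def]
    ring
  rw [hpoly]
  exact Differentiable.fun_sum fun i _ => (differentiable_pow i).smul_const _

end EqCohomology

section Components

open EqCohomology

variable {n : ℕ} {z : Fin n → ℂ}

/-- The shift `(∑ z_a + (n-1)/2) / n` of the integration variable after which the parameters of the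
Gamma functions in each component have the sum `(n-1)/2` for which the leading terms of
`gammaKernel` and of the Gamma function agree. -/
def centre (z : Fin n → ℂ) : ℂ := (∑ a, z a + ((n : ℂ) - 1) / 2) / n

/-- The equivariant parameters measured from `centre z`. -/
def centredParam (z : Fin n → ℂ) (a : Fin n) : ℂ := z a - centre z

/-- The Gamma parameters at the `b`-th fixed point, where `W` restricts to
`∏_{a ≠ b} (z_a - t)` and so turns `Γ(z_a - t)` into `Γ(z_a - t + 1)` for `a ≠ b`. -/
def componentParam (z : Fin n → ℂ) (b : Fin n) : Fin n → ℂ :=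
  shiftParam (Finset.univ.erase b) (centredParam z)

/-- The logarithm of `e^{πi(2-n)} p`. -/
def twistedLog (n : ℕ) (logp : ℂ) : ℂ := logp + Real.pi * I * (2 - (n : ℂ))

lemma injective_of_sub_ne_intCast (hz : ∀ a b, a ≠ b → ∀ k : ℤ, z a - z b ≠ k) :
    Function.Injective z := fun a b hab => by
  by_contra hne
  exact hz a b hne 0 (by simp [hab])

lemma centredParam_sub_ne (hz : ∀ a b, a ≠ b → ∀ k : ℤ, z a - z b ≠ k) (a b : Fin n)
    (hab : a ≠ b) (k : ℤ) : centredParam z a - centredParam z b ≠ k := by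
  rw [centredParam, centredParam, sub_sub_sub_cancel_right]
  exact hz a b hab k

lemma sum_componentParam (hn : 0 < n) (b : Fin n) :
    ∑ a, componentParam z b a = ((n : ℂ) - 1) / 2 := by
  have hn0 : (n : ℂ) ≠ 0 := Nat.cast_ne_zero.2 hn.ne'
  simp only [componentParam, sum_shiftParam, card_univ_erase, centredParam, centre,
    Finset.sum_sub_distrib, Finset.sum_const, Finset.card_univ, Fintype.card_fin, nsmul_eq_mul,
    Nat.cast_pred hn]
  field_simp
  ring

lemma masterFunction_eq (hn : 0 < n) (t logp : ℂ) :
    masterFunction t logp z = exp (centre z * twistedLog n logp) *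
      gammaKernel (centredParam z) (twistedLog n logp / n) (n * (centre z - t)) := by
  have hn0 : (n : ℂ) ≠ 0 := Nat.cast_ne_zero.2 hn.ne'
  rw [masterFunction, gammaKernel, ← mul_assoc, ← exp_add, mul_div_cancel_left₀ _ hn0]
  congr 2
  · rw [twistedLog]; field_simp; ring
  · funext a; rw [centredParam]; congr 1; ring

lemma meromorphicAt_masterFunction (logp t : ℂ) :
    MeromorphicAt (fun t => masterFunction t logp z) t := by
  unfold masterFunction
  refine MeromorphicAt.fun_mul (by fun_prop) (MeromorphicAt.fun_prod fun a _ => ?_)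
  exact (Meromorphic.Gamma (z a - t)).comp_analyticAt (g := fun t => z a - t) (by fun_prop)

lemma tendsto_centre_sub (hn : 0 < n) (J : Fin n) (k : ℕ) :
    Tendsto (fun t : ℂ => n * (centre z - t)) (𝓝[≠] (z J + k))
      (𝓝[≠] gammaPole (centredParam z) J k) := by
  have hn0 : (n : ℂ) ≠ 0 := Nat.cast_ne_zero.2 hn.ne'
  have hderiv := ((hasDerivAt_id (z J + k)).const_sub (centre z)).const_mul (n : ℂ)
  have hpole : gammaPole (centredParam z) J k = n * (centre z - (z J + k)) := by
    rw [gammaPole, centredParam]; ring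
  rw [hpole]
  exact hderiv.tendsto_nhdsNE (by simpa using hn0)

lemma tendsto_sub_mul_masterFunction (hn : 0 < n) (hz : ∀ a b, a ≠ b → ∀ k : ℤ, z a - z b ≠ k)
    (J : Fin n) (k : ℕ) (logp : ℂ) :
    Tendsto (fun t => (t - (z J + k)) * masterFunction t logp z) (𝓝[≠] (z J + k))
      (𝓝 (-(exp (centre z * twistedLog n logp) / n) *
        gammaResidue (centredParam z) (twistedLog n logp / n) J k)) := by
  have hn0 : (n : ℂ) ≠ 0 := Nat.cast_ne_zero.2 hn.ne'
  have hlim := (tendsto_sub_gammaPole_mul_gammaKernel (ℓ := twistedLog n logp / n) hn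
    (centredParam_sub_ne hz) J k).comp (tendsto_centre_sub hn J k)
  refine (hlim.const_mul _).congr fun t => ?_
  simp only [masterFunction_eq hn, Function.comp_apply, gammaPole, centredParam]
  field_simp
  ring

lemma residue_masterFunction_smul_W (hn : 0 < n) (hz : ∀ a b, a ≠ b → ∀ k : ℤ, z a - z b ≠ k)
    (J : Fin n) (k : ℕ) (logp : ℂ) :
    residue (fun t => masterFunction t logp z • W z t) (z J + k) =
      (-(exp (centre z * twistedLog n logp) / n) *
        gammaResidue (centredParam z) (twistedLog n logp / n) J k) • W z (z J + k) := by
  refine residue_eq_of_tendsto ?_ ?_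
  · filter_upwards [(meromorphicAt_masterFunction logp (z J + k)).eventually_analyticAt] with t ht
    exact ht.differentiableAt.smul (differentiable_W t)
  · have hW : Tendsto (W z) (𝓝[≠] (z J + k)) (𝓝 (W z (z J + k))) :=
      (differentiable_W.continuous.tendsto _).mono_left nhdsWithin_le_nhds
    exact ((tendsto_sub_mul_masterFunction hn hz J k logp).smul hW).congr fun t => mul_smul _ _ _

lemma evalAt_PsiJ (hn : 0 < n) (hz : ∀ a b, a ≠ b → ∀ k : ℤ, z a - z b ≠ k) (b J : Fin n)
    (logp : ℂ) :
    evalAt z b (PsiJ J logp z) = exp (centre z * twistedLog n logp) / n *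
      ∑' k, gammaResidue (componentParam z b) (twistedLog n logp / n) J k := by
  have hsum (b : Fin n) := (hasSum_prod_mul_gammaResidue (ℓ := twistedLog n logp / n) hn
    (centredParam_sub_ne hz) (Finset.univ.erase b) J).mul_left
      (-(exp (centre z * twistedLog n logp) / n))
  have hres (b : Fin n) (k : ℕ) :
      evalAt z b (residue (fun t => masterFunction t logp z • W z t) (z J + k)) =
        -(exp (centre z * twistedLog n logp) / n) *
          ((∏ a ∈ Finset.univ.erase b, (centredParam z a - centredParam z J - k)) *
            gammaResidue (centredParam z) (twistedLog n logp / n) J k) := by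
    simp only [residue_masterFunction_smul_W hn hz, map_smul, evalAt_W, smul_eq_mul, centredParam,
      sub_sub_sub_cancel_right, sub_add_eq_sub_sub]
    ring
  rw [PsiJ, map_neg, evalAt_tsum (injective_of_sub_ne_intCast hz) fun b =>
    (hsum b).congr_fun (hres b), neg_mul, neg_neg]
  rfl

/-- The sum of all residues of the kernel at the `b`-th fixed point. -/
def residueSum (z : Fin n → ℂ) (b : Fin n) (ℓ : ℂ) : ℂ :=
  ∑ J, ∑' k, gammaResidue (componentParam z b) ℓ J k

lemma evalAt_Psi (hn : 0 < n) (hz : ∀ a b, a ≠ b → ∀ k : ℤ, z a - z b ≠ k) (b : Fin n)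
    {logp ℓ : ℂ} {m : ℤ}
    (hℓ : n * ℓ = twistedLog n logp + (m - 1 : ℤ) * (2 * Real.pi * I)) :
    evalAt z b (Psi m logp z) = exp (centre z * (n * ℓ)) / n * residueSum z b ℓ := by
  have hn0 : (n : ℂ) ≠ 0 := Nat.cast_ne_zero.2 hn.ne'
  rw [Psi, PsiQ, map_sum, residueSum, Finset.mul_sum]
  refine Finset.sum_congr rfl fun J _ => ?_
  have hphase : exp (2 * Real.pi * I * z J) ^ (m - 1) * exp (centre z * twistedLog n logp) =
      exp (centre z * (n * ℓ)) *
        exp ((m - 1 : ℤ) * (2 * Real.pi * I) * componentParam z b J) := by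
    rw [componentParam, exp_intCast_mul_shiftParam, ← exp_int_mul, ← exp_add, ← exp_add, hℓ,
      centredParam]
    congr 1; ring
  have hbranch (k : ℕ) := gammaResidue_of_mul_eq_add (α := componentParam z b)
    (ℓ := twistedLog n logp / n) (by rw [hℓ, mul_div_cancel₀ _ hn0]) J k
  simp only [hbranch, tsum_mul_left, map_smul, evalAt_PsiJ hn hz, smul_eq_mul]
  linear_combination (∑' k, gammaResidue (componentParam z b) (twistedLog n logp / n) J k) / n *
    hphase

end Components

section Asymptotics

lemma isBigO_mul_sub_one {ι : Type*} {l : Filter ι} {f g : ι → ℂ} {h : ι → ℝ}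
    (hh : Tendsto h l (𝓝 0)) (hf : (fun i => f i - 1) =O[l] h) (hg : (fun i => g i - 1) =O[l] h) :
    (fun i => f i * g i - 1) =O[l] h := by
  have hcross : (fun i => (f i - 1) * (g i - 1)) =O[l] h := by
    simpa using hf.mul (hg.trans (hh.isBigO_one ℝ))
  exact ((hcross.add hf).add hg).congr_left fun i => by ring

lemma isBigO_prod_sub_one {ι κ : Type*} {l : Filter ι} {h : ι → ℝ} (hh : Tendsto h l (𝓝 0))
    (s : Finset κ) {f : κ → ι → ℂ} (hf : ∀ k, (fun i => f k i - 1) =O[l] h) :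
    (fun i => ∏ k ∈ s, f k i - 1) =O[l] h := by
  classical
  induction s using Finset.induction_on with
  | empty => simpa using isBigO_zero h l
  | insert k s hk ih =>
    simp only [Finset.prod_insert hk]
    exact isBigO_mul_sub_one hh (hf k) ih

lemma isBigO_ofReal_mul_add_ofReal_mul (a : ℂ) {u : ℂ} (hu : u ≠ 0) :
    (fun r : ℝ => (r : ℂ) * u) =O[atTop] fun r : ℝ => a + r * u := by
  refine IsLittleO.right_isBigO_add ((isLittleO_const_left.2 (Or.inr ?_)))
  simpa [Function.comp_def] using
    tendsto_norm_atTop_atTop.atTop_mul_const (norm_pos_iff.2 hu)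

lemma eventually_add_ofReal_mul_ne_zero (a : ℂ) {u : ℂ} (hu : u ≠ 0) :
    ∀ᶠ r : ℝ in atTop, a + r * u ≠ 0 := by
  filter_upwards [(isBigO_ofReal_mul_add_ofReal_mul a hu).eq_zero_imp, eventually_gt_atTop 0]
    with r hzero hr h
  exact mul_ne_zero (ofReal_ne_zero.2 hr.ne') hu (hzero h)

lemma isBigO_div_add_sub_one (a : ℂ) {u : ℂ} (hu : u ≠ 0) :
    (fun r : ℝ => (r : ℂ) * u / (a + r * u) - 1) =O[atTop] fun r : ℝ => r⁻¹ := by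
  have hinv : (fun r : ℝ => (a + r * u)⁻¹) =O[atTop] fun r : ℝ => r⁻¹ := by
    refine ((isBigO_ofReal_mul_add_ofReal_mul a hu).inv_rev ?_).trans ?_
    · filter_upwards [eventually_gt_atTop 0] with r hr h
      exact absurd h (mul_ne_zero (ofReal_ne_zero.2 hr.ne') hu)
    · exact IsBigO.of_bound ‖u‖⁻¹ (Eventually.of_forall fun r => by simp)
  refine (hinv.const_mul_left (-a)).congr' ?_ EventuallyEq.rfl
  filter_upwards [eventually_add_ofReal_mul_ne_zero a hu] with r hr
  field_simp
  ring

end Asymptotics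

section Psi

open EqCohomology

variable {n : ℕ} {z : Fin n → ℂ} {θ : ℝ}

lemma gaussConst_ne_zero (hn : 0 < n) : (gaussConst n : ℂ) ≠ 0 := by
  rw [gaussConst]
  exact ofReal_ne_zero.2 (by positivity)

lemma gaussConst_div (hn : 0 < n) :
    gaussConst n / n = (2 * Real.pi) ^ (((n : ℝ) - 1) / 2) / √n := by
  have hn0 : (0 : ℝ) < n := Nat.cast_pos.2 hn
  have hpow : (2 * Real.pi) ^ (((n : ℝ) - 1) / 2) = √(2 * Real.pi) ^ n / √(2 * Real.pi) := by
    rw [sub_div, Real.rpow_sub Real.two_pi_pos, ← Real.sqrt_eq_rpow, Real.sqrt_eq_rpow,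
      ← Real.rpow_natCast, ← Real.rpow_mul Real.two_pi_pos.le]
    congr 2
    ring
  rw [gaussConst, hpow, div_eq_div_iff hn0.ne' (Real.sqrt_pos.2 hn0).ne', mul_assoc,
    Real.mul_self_sqrt hn0.le]

lemma isBigO_residueSum_sub (hn : 0 < n) (hz : ∀ a b, a ≠ b → ∀ k : ℤ, z a - z b ≠ k)
    (b : Fin n) (hθ : θ ∈ Ioo (-Real.pi) Real.pi) :
    (fun r : ℝ => residueSum z b (Real.log r + θ * I) -
      gaussConst n * exp (-(n * (r * exp (θ * I)))))
      =O[atTop] fun r : ℝ => (r : ℂ)⁻¹ * exp (-(n * (r * exp (θ * I)))) := by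
  have hn0 : (0 : ℝ) < n := Nat.cast_pos.2 hn
  have him : (θ * I).im ∈ Ioo (-Real.pi) Real.pi := by simpa using hθ
  have hlog : log (exp (θ * I)) = θ * I := log_exp him.1 him.2.le
  obtain ⟨C, hC⟩ := exists_norm_sum_gammaResidue_sub_le hn
    (shiftParam_sub_ne (centredParam_sub_ne hz) _) (sum_componentParam hn b)
    (norm_exp_ofReal_mul_I θ) (expOpenPartialHomeomorph.map_source him)
  refine IsBigO.of_bound (C / n) ?_
  filter_upwards [(tendsto_id.const_mul_atTop hn0).eventually hC, eventually_gt_atTop 0]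
    with r hbound hr
  have hbranch : log ((n * r : ℝ) * exp (θ * I)) - (Real.log n : ℝ) = Real.log r + θ * I := by
    rw [log_ofReal_mul (by positivity) (exp_ne_zero _), hlog, Real.log_mul hn0.ne' hr.ne']
    push_cast
    ring
  simp only [id, hbranch] at hbound
  rw [ofReal_mul, ofReal_natCast, mul_assoc] at hbound
  refine hbound.trans_eq ?_
  rw [norm_mul, norm_inv, norm_real, Real.norm_of_nonneg hr.le]
  field_simp

lemma isBigO_residueSum_div_sub_one (hn : 0 < n) (hz : ∀ a b, a ≠ b → ∀ k : ℤ, z a - z b ≠ k)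
    (b : Fin n) (hθ : θ ∈ Ioo (-Real.pi) Real.pi) :
    (fun r : ℝ => residueSum z b (Real.log r + θ * I) /
      (gaussConst n * exp (-(n * (r * exp (θ * I))))) - 1) =O[atTop] fun r : ℝ => r⁻¹ := by
  have hquot := (isBigO_residueSum_sub hn hz b hθ).mul (isBigO_refl
    (fun r : ℝ => (gaussConst n * exp (-(n * (r * exp (θ * I)))))⁻¹) atTop)
  have hg := gaussConst_ne_zero hn
  have hscale : (fun r : ℝ => (r : ℂ)⁻¹ * (gaussConst n : ℂ)⁻¹) =O[atTop] fun r : ℝ => r⁻¹ :=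
    IsBigO.of_bound ‖(gaussConst n : ℂ)⁻¹‖ (Eventually.of_forall fun r => by simp [mul_comm])
  refine (hquot.congr (fun r => ?_) fun r => ?_).trans hscale <;> field_simp

/-- The value at the `b`-th fixed point of the relative error in the asymptotics of `Ψ^m`, along
the ray on which `-ω^m s` has argument `θ`. -/
def relError (z : Fin n → ℂ) (θ : ℝ) (b : Fin n) (r : ℝ) : ℂ :=
  residueSum z b (Real.log r + θ * I) / (gaussConst n * exp (-(n * (r * exp (θ * I))))) *
    (∏ a ∈ Finset.univ.erase b, r * exp (θ * I) / (z a + r * exp (θ * I))) - 1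

lemma isBigO_relError (hn : 0 < n) (hz : ∀ a b, a ≠ b → ∀ k : ℤ, z a - z b ≠ k) (b : Fin n)
    (hθ : θ ∈ Ioo (-Real.pi) Real.pi) : relError z θ b =O[atTop] fun r : ℝ => r⁻¹ :=
  isBigO_mul_sub_one tendsto_inv_atTop_zero (isBigO_residueSum_div_sub_one hn hz b hθ)
    (isBigO_prod_sub_one tendsto_inv_atTop_zero _ fun a =>
      isBigO_div_add_sub_one (z a) (exp_ne_zero _))

lemma exp_centre_mul (hn : 0 < n) (ℓ : ℂ) :
    exp (centre z * (n * ℓ)) =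
      exp ((∑ a, z a + (1 - (n : ℂ)) / 2) * ℓ) * exp ℓ ^ (n - 1) := by
  have hn0 : (n : ℂ) ≠ 0 := Nat.cast_ne_zero.2 hn.ne'
  rw [← exp_nat_mul, ← exp_add, Nat.cast_pred hn, centre]
  congr 1
  field_simp
  ring

lemma evalAt_Psi_eq (hn : 0 < n) (hz : ∀ a b, a ≠ b → ∀ k : ℤ, z a - z b ≠ k) (b : Fin n)
    {r : ℝ} (hr : 0 < r) {logp : ℂ} {m : ℤ}
    (hlog : n * (Real.log r + θ * I) = twistedLog n logp + (m - 1 : ℤ) * (2 * Real.pi * I))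
    (hne : ∀ a, z a + r * exp (θ * I) ≠ 0) :
    evalAt z b (Psi m logp z) =
      (gaussConst n / n * exp (-(n * (r * exp (θ * I)))) *
        exp ((∑ a, z a + (1 - (n : ℂ)) / 2) * (Real.log r + θ * I))) *
      (evalAt z b (W z (-(r * exp (θ * I)))) * (1 + relError z θ b r)) := by
  have hexp : exp (Real.log r + θ * I) = r * exp (θ * I) := by
    rw [exp_add, ← ofReal_exp, Real.exp_log hr]
  have hprod : ∏ a ∈ Finset.univ.erase b, (z a + r * exp (θ * I)) ≠ 0 :=
    Finset.prod_ne_zero_iff.2 fun a _ => hne a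
  have hg := gaussConst_ne_zero hn
  rw [evalAt_Psi hn hz b hlog, exp_centre_mul hn, hexp, relError, evalAt_W,
    Finset.prod_div_distrib, Finset.prod_const, card_univ_erase, add_sub_cancel]
  simp only [sub_neg_eq_add]
  field_simp

lemma exists_isBigO_Psi_eq (hn : 0 < n) (hz : ∀ a b, a ≠ b → ∀ k : ℤ, z a - z b ≠ k)
    (hθ : θ ∈ Ioo (-Real.pi) Real.pi) {logp : ℝ → ℂ} {m : ℤ}
    (hlog : ∀ r, n * (Real.log r + θ * I) =
      twistedLog n (logp r) + (m - 1 : ℤ) * (2 * Real.pi * I)) :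
    ∃ E : ℝ → EqCohomology z, (E =O[atTop] fun r : ℝ => r⁻¹) ∧ ∀ᶠ r : ℝ in atTop,
      Psi m (logp r) z =
        ((((2 * Real.pi) ^ (((n : ℝ) - 1) / 2) / √n : ℝ) : ℂ) * exp (-(n * (r * exp (θ * I)))) *
          exp ((∑ a, z a + (1 - (n : ℂ)) / 2) * (Real.log r + θ * I))) •
        (W z (-(r * exp (θ * I))) * (1 + E r)) := by
  have hinj := injective_of_sub_ne_intCast hz
  refine ⟨fun r => ∑ b, relError z θ b r • idem z b, IsBigO.fun_sum fun b _ => ?_, ?_⟩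
  · exact (IsBigO.of_bound ‖idem z b‖ (Eventually.of_forall fun r => by
      rw [norm_smul, mul_comm])).trans (isBigO_relError hn hz b hθ)
  · filter_upwards [eventually_gt_atTop 0,
      eventually_all.2 fun a => eventually_add_ofReal_mul_ne_zero (z a) (exp_ne_zero (θ * I))]
      with r hr hne
    refine eq_of_forall_evalAt hinj fun b => ?_
    rw [evalAt_Psi_eq hn hz b hr (hlog r) hne, map_smul, map_mul, map_add, map_one,
      evalAt_sum_smul_idem hinj, smul_eq_mul, ← gaussConst_div hn, ofReal_div, ofReal_natCast]

/-- The argument of `-ω^m s`, where `s = r e^{-2πiφ}` and `ω = e^{2πi/n}`. -/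
def negOmegaArg (n : ℕ) (m : ℤ) (φ : ℝ) : ℝ := 2 * Real.pi * m / n - Real.pi - 2 * Real.pi * φ

lemma negOmegaArg_mem_Ioo {m : ℤ} {φ : ℝ} (hφ₁ : (m : ℝ) / n - 1 < φ) (hφ₂ : φ < (m : ℝ) / n) :
    negOmegaArg n m φ ∈ Ioo (-Real.pi) Real.pi := by
  have hfactor : negOmegaArg n m φ = 2 * Real.pi * ((m : ℝ) / n - φ) - Real.pi := by
    rw [negOmegaArg]; ring
  rw [hfactor]
  constructor <;> nlinarith [Real.pi_pos]

lemma exp_zpow_mul_exp_eq (n : ℕ) (m : ℤ) (φ : ℝ) :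
    exp (2 * Real.pi * I / n) ^ m * exp (-2 * Real.pi * I * φ) =
      -exp (negOmegaArg n m φ * I) := by
  have hadd : negOmegaArg n m φ * I =
      m * (2 * Real.pi * I / n) + -2 * Real.pi * I * φ - Real.pi * I := by
    rw [negOmegaArg]; push_cast; ring
  rw [hadd, exp_sub, exp_add, exp_int_mul, exp_pi_mul_I, div_neg, div_one, neg_neg]

lemma mul_log_add_negOmegaArg (hn : 0 < n) (m : ℤ) (φ r : ℝ) :
    n * (Real.log r + negOmegaArg n m φ * I) =
      twistedLog n (n * (Real.log r - 2 * Real.pi * I * φ)) + (m - 1 : ℤ) * (2 * Real.pi * I) := by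
  have hn0 : (n : ℂ) ≠ 0 := Nat.cast_ne_zero.2 hn.ne'
  rw [negOmegaArg, twistedLog]
  push_cast
  field_simp
  ring

end Psi

end QuantumPn

end

open QuantumPn in
/-- Here `log s = log r - 2πiφ` and `log p = n log s` fix the arguments of `s = r e^{-2πiφ}` and
`p = s^n`, and the power of `-ω^m s` is taken with the argument `2πm/n - π - 2πφ`. -/
theorem lemma5p1 (n : ℕ) (hn : 2 ≤ n) (z : Fin n → ℂ)
    (hz : ∀ a b : Fin n, a ≠ b → ∀ k : ℤ, z a - z b ≠ (k : ℂ))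
    (m : ℤ) (φ : ℝ) (hφ₁ : (m : ℝ) / n - 1 < φ) (hφ₂ : φ < (m : ℝ) / n) :
    ∃ E : ℝ → EqCohomology z,
      (E =O[atTop] fun r : ℝ => ((r : ℂ) * Complex.exp (-2 * Real.pi * Complex.I * φ))⁻¹) ∧
      ∀ᶠ r : ℝ in atTop,
        let logs : ℂ := Real.log r - 2 * Real.pi * Complex.I * φ
        let s : ℂ := r * Complex.exp (-2 * Real.pi * Complex.I * φ)
        let ω : ℂ := Complex.exp (2 * Real.pi * Complex.I / n)
        let logNegωs : ℂ :=
          Real.log r + (2 * Real.pi * m / n - Real.pi - 2 * Real.pi * φ) * Complex.I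
        Psi m (n * logs) z =
          ((((2 * Real.pi) ^ (((n : ℝ) - 1) / 2) / Real.sqrt n : ℝ) : ℂ)
            * Complex.exp (n * ω ^ m * s)
            * Complex.exp ((∑ a, z a + (1 - (n : ℂ)) / 2) * logNegωs))
          • (EqCohomology.W z (ω ^ m * s) * (1 + E r)) := by
  have hn0 : 0 < n := by lia
  obtain ⟨E, hE, hPsi⟩ := exists_isBigO_Psi_eq hn0 hz (negOmegaArg_mem_Ioo hφ₁ hφ₂)
    (mul_log_add_negOmegaArg hn0 m φ)
  refine ⟨E, (hE.norm_right.congr_right fun r => ?_).of_norm_right, ?_⟩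
  · simp [Complex.norm_exp]
  filter_upwards [hPsi] with r hr
  intro logs s ω logNegωs
  have hs : ω ^ m * s = -(r * Complex.exp (negOmegaArg n m φ * Complex.I)) := by
    rw [mul_left_comm, exp_zpow_mul_exp_eq, mul_neg]
  have hlog : logNegωs = Real.log r + negOmegaArg n m φ * Complex.I := by
    rw [negOmegaArg]
    push_cast
    rfl
  rw [hr, mul_assoc (n : ℂ), hs, hlog, mul_neg]
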